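/- Let $I=[-1,1]$, and let $\mathcal M^{\square}$ be the compact space of Borel probability measures on $I$ with the weak-$*$ topology. For a Radon measure $\mu$ on $\mathbb R$, $x\in\operatorname{supp}\mu$ and $t\ge 0$ write $I_t=e^{-t}I$, $A_t=e^{-t}A$, and let $\mu_{x,t}\in\mathcal M^{\square}$ be given by $\mu_{x,t}(A)=\mu(x+A_t)/\mu(x+I_t)$ for Borel sets $A\subset I$. A \emph{distribution} is a Borel probability measure on $\mathcal M^{\square}$. For $T>0$ let $\langle\mu\rangle_{x,T}$ be the distribution $E\mapsto\frac1T\lambda(\{t\in[0,T]:\mu_{x,t}\in E\})$, where $\lambda$ is Lebesgue measure; $\mu$ \emph{generates} the distribution $P$ at $x\in\operatorname{supp}\mu$ if $\langle\mu\rangle_{x,T}\to P$ weak-$*$ as $T\to\infty$, that is, if $\int g\,d\langle\mu\rangle_{x,T}\to\int g\,dP$ for every $g\in C(\mathcal M^{\square})$. Let $\Lambda$ be a countable set with at least two elements and let $([l])_{l\in\Lambda}$ be non-degenerate compact subintervals of $I$ with pairwise disjoint interiors. Let $\sigma:\bigcup_l[l]\to I$ be an orientation-preserving piecewise linear shift map: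 $\sigma$ maps the interior of each $[l]$ affinely and increasingly onto $(-1,1)$, maps the endpoints of each $[l]$ into $\{-1,1\}$, and is uniformly expanding on the interiors of the $[l]$ (there is $c>1$ with $|\sigma(x)-\sigma(y)|\ge c|x-y|$ for all $l$ and all $x,y$ in the interior of $[l]$). The cylinder of generation $n$ with digits $l_1,\dots,l_n$ is $$[l_1\ldots l_n]=\overline{\{x\in I:\ \sigma^{k-1}(x)\in\operatorname{int}[l_k]\text{ for }k=1,\dots,n\}},$$ and the cylinder of generation $0$ is $I$. Let $(p_l)_{l\in\Lambda}$ be positive numbers with $\sum_l p_l=1$, and let $\mu$ be the corresponding Bernoulli measure, i.e. the Borel probability measure with $\mu([l_1\ldots l_n])=p_{l_1}\cdots p_{l_n}$ for all cylinders. For $k\ge 0$ and $x\in\mathbb R$ define $T_k(x)\in[0,\infty]$ as $\inf\{t\ge0:\ x+I_t\subset C\}$ if $x$ lies in the interior of a (necessarily unique) cylinder $C$ of generation $k$, and $T_k(x)=\infty$ otherwise. $\mu$-almost everywhere all $T_k$ are finite. Suppose that $T_1-T_0$ is $\mu$-integrable. Then $\int(T_1-T_0)\,d\mu>0$, there is exactly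 one distribution $P$ such that $$\int g\,dP=\frac{1}{\int(T_1-T_0)\,d\mu}\int\int_{T_0(x)}^{T_1(x)}g(\mu_{x,t})\,dt\,d\mu(x)\qquad\text{for all } g\in C(\mathcal M^{\square}),$$ and $\mu$ generates this $P$ at $\mu$-almost every $x$. -/

import Mathlib

open MeasureTheory Filter Topology
open scoped ENNReal

noncomputable section

/-- The interval `I = [-1, 1]`. -/
abbrev unitWindow : Set ℝ := Set.Icc (-1) 1

instance unitWindow.instNonempty : Nonempty unitWindow := ⟨⟨0, by norm_num⟩⟩

/-- The map `a ↦ x + e^{-t} a` from `I` onto the window `x + I_t`. -/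
def zoom (x t : ℝ) (a : unitWindow) : ℝ := x + Real.exp (-t) * (a : ℝ)

theorem zoom_measurableEmbedding (x t : ℝ) : MeasurableEmbedding (zoom x t) := by
  have hc : Continuous (zoom x t) := by unfold zoom; fun_prop
  refine (hc.isClosedEmbedding ?_).measurableEmbedding
  intro a b hab
  have h : x + Real.exp (-t) * (a : ℝ) = x + Real.exp (-t) * (b : ℝ) := hab
  exact Subtype.ext (mul_left_cancel₀ (Real.exp_pos _).ne' (add_left_cancel h))

/-- The window `x + I_t = x + e^{-t} I` of radius `e^{-t}` around `x`. -/
def window (x t : ℝ) : Set ℝ := Set.range (zoom x t)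

/-- The measure `A ↦ μ (x + A_t)` on `I`, before normalisation. -/
def rawScenery (μ : Measure ℝ) (x t : ℝ) : Measure unitWindow := μ.comap (zoom x t)

theorem rawScenery_apply (μ : Measure ℝ) (x t : ℝ) (A : Set unitWindow) :
    rawScenery μ x t A = μ (zoom x t '' A) :=
  (zoom_measurableEmbedding x t).comap_apply μ A

instance rawScenery.instIsFiniteMeasure (μ : Measure ℝ) [IsLocallyFiniteMeasure μ] (x t : ℝ) :
    IsFiniteMeasure (rawScenery μ x t) := by
  refine ⟨?_⟩
  rw [rawScenery_apply, Set.image_univ]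
  have hc : Continuous (zoom x t) := by unfold zoom; fun_prop
  exact (isCompact_range hc).measure_lt_top

/-- The measure `A ↦ μ (x + A_t)` as a finite measure. -/
def rawSceneryFinite (μ : Measure ℝ) [IsLocallyFiniteMeasure μ] (x t : ℝ) :
    FiniteMeasure unitWindow := ⟨rawScenery μ x t, inferInstance⟩

/-- The space `M` of Borel probability measures on `I` with the weak-* topology and the
Borel σ-algebra of that topology. -/
def ProbWindow : Type := ProbabilityMeasure unitWindow

instance ProbWindow.instTopologicalSpace : TopologicalSpace ProbWindow :=
  inferInstanceAs (TopologicalSpace (ProbabilityMeasure unitWindow))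

instance ProbWindow.instMeasurableSpace : MeasurableSpace ProbWindow := borel ProbWindow

instance ProbWindow.instBorelSpace : BorelSpace ProbWindow := ⟨rfl⟩

/-- The scenery `μ_{x,t}(A) = μ (x + A_t) / μ (x + I_t)`. It is meaningful when
`μ (x + I_t) > 0`, in particular for every `x` in the support of `μ`. -/
def scenery (μ : Measure ℝ) [IsLocallyFiniteMeasure μ] (x t : ℝ) : ProbWindow :=
  (rawSceneryFinite μ x t).normalize

theorem scenery_apply (μ : Measure ℝ) [IsLocallyFiniteMeasure μ] (x t : ℝ)
    (h : μ (window x t) ≠ 0) (A : Set unitWindow) :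
    (scenery μ x t).1 A = μ (zoom x t '' A) / μ (window x t) := by
  have hw : rawScenery μ x t Set.univ = μ (window x t) := by
    rw [rawScenery_apply, Set.image_univ]; rfl
  have hne : rawSceneryFinite μ x t ≠ 0 := by
    intro h0
    apply h
    have h1 : rawScenery μ x t = 0 :=
      congrArg (fun ν : FiniteMeasure unitWindow => (ν : Measure unitWindow)) h0
    rw [← hw, h1]; rfl
  have hm : ((rawSceneryFinite μ x t).mass : ℝ≥0∞) = μ (window x t) := by
    rw [FiniteMeasure.ennreal_mass]; exact hw
  have key := FiniteMeasure.toMeasure_normalize_eq_of_nonzero (rawSceneryFinite μ x t) hne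
  change ((rawSceneryFinite μ x t).normalize : Measure unitWindow) A = _
  rw [key, Measure.smul_apply, ENNReal.smul_def,
    ENNReal.coe_inv ((FiniteMeasure.mass_nonzero_iff _).2 hne), hm, ENNReal.div_eq_inv_mul,
    smul_eq_mul]
  congr 1
  exact rawScenery_apply μ x t A

/-- The measure `E ↦ T⁻¹ λ {t ∈ [0, T] : μ_{x,t} ∈ E}` on the Borel sets of `M`. -/
def sceneryDistribution (μ : Measure ℝ) [IsLocallyFiniteMeasure μ] (x T : ℝ) :
    Measure ProbWindow :=
  (ENNReal.ofReal T)⁻¹ • (volume.restrict (Set.Icc 0 T)).map (fun t => scenery μ x t)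

/-- `μ` generates the distribution `P` at `x`: `x` lies in the support of `μ`, and the
distributions of the scenery over `[0, T]` converge to `P` in the weak-* topology. -/
def Generates (μ : Measure ℝ) [IsLocallyFiniteMeasure μ] (x : ℝ)
    (P : ProbabilityMeasure ProbWindow) : Prop :=
  x ∈ μ.support ∧ ∀ g : C(ProbWindow, ℝ),
    Tendsto (fun T : ℝ => ∫ ν, g ν ∂(sceneryDistribution μ x T)) atTop
      (𝓝 (∫ ν, g ν ∂(P : Measure ProbWindow)))

/-- A piecewise linear shift map, with basic intervals `[l] = [left l, right l] ⊆ I`. The map is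
written as a function on `ℝ`, but only its values on the union of the basic intervals matter. -/
structure PiecewiseLinearShift (Λ : Type*) where
  left : Λ → ℝ
  right : Λ → ℝ
  left_lt_right : ∀ l, left l < right l
  subset_window : ∀ l, Set.Icc (left l) (right l) ⊆ unitWindow
  disjoint_interiors :
    Pairwise fun l m => Disjoint (Set.Ioo (left l) (right l)) (Set.Ioo (left m) (right m))
  map : ℝ → ℝ
  linear : ∀ l, ∃ a b : ℝ, ∀ x ∈ Set.Ioo (left l) (right l), map x = a * x + b
  image_interior : ∀ l, map '' Set.Ioo (left l) (right l) = Set.Ioo (-1) 1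
  map_left : ∀ l, map (left l) = -1 ∨ map (left l) = 1
  map_right : ∀ l, map (right l) = -1 ∨ map (right l) = 1
  expanding : ∃ c : ℝ, 1 < c ∧ ∀ l, ∀ x ∈ Set.Ioo (left l) (right l),
    ∀ y ∈ Set.Ioo (left l) (right l), c * |x - y| ≤ |map x - map y|

namespace PiecewiseLinearShift

variable {Λ : Type*}

/-- The map is increasing on the interior of each basic interval. -/
def OrientationPreserving (σ : PiecewiseLinearShift Λ) : Prop :=
  ∀ l, StrictMonoOn σ.map (Set.Ioo (σ.left l) (σ.right l))

/-- The cylinder `[w₀ … w_{n-1}]`: the closure of the set of points of `I` whose first `n` iterates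
`x, σ x, …, σ^{n-1} x` lie in the interiors of the prescribed basic intervals. For `n = 0` it
is `I`. -/
def cylinder (σ : PiecewiseLinearShift Λ) {n : ℕ} (w : Fin n → Λ) : Set ℝ :=
  closure {x | x ∈ unitWindow ∧
    ∀ i : Fin n, σ.map^[(i : ℕ)] x ∈ Set.Ioo (σ.left (w i)) (σ.right (w i))}

/-- `μ` is the Bernoulli measure for the weights `p`. -/
def IsBernoulli (σ : PiecewiseLinearShift Λ) (p : Λ → ℝ) (μ : Measure ℝ) : Prop :=
  ∀ (n : ℕ) (w : Fin n → Λ), μ (σ.cylinder w) = ENNReal.ofReal (∏ i, p (w i))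

/-- The entry time `T_k(x) ∈ [0, ∞]`: the infimum of the `t ≥ 0` for which the window `x + I_t` is
contained in the generation `k` cylinder whose interior contains `x`. The infimum is over the
empty set, hence `∞`, when there is no such cylinder. -/
def entryTime (σ : PiecewiseLinearShift Λ) (k : ℕ) (x : ℝ) : ℝ≥0∞ :=
  sInf {s : ℝ≥0∞ | ∃ (w : Fin k → Λ) (t : ℝ), x ∈ interior (σ.cylinder w) ∧ 0 ≤ t ∧
    window x t ⊆ σ.cylinder w ∧ s = ENNReal.ofReal t}

end PiecewiseLinearShift

end

/-! Code points by their digits. The image of the product measure `ν` of the weights under `code` is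
`μ`, and the left shift is ergodic for `ν` by Kolmogorov's zero-one law. For almost every ω all
shifts of ω are coded by points of (-1, 1). The distance from x = `code ω` to the boundary of its
generation n cylinder is then `scale n ω * (1 - |code (seqShift^[n] ω)|)`, and the entry time T_n(x)
is minus the logarithm of this. It follows that T_{n+1} - T_n is T_1 - T_0 evaluated at the n-th
shift, so T_n - T_0 is a Birkhoff sum (`codeTime_eq_birkhoffSum`).

On a cylinder, `μ` is a multiple of a scaled copy of itself, and normalisation removes the multiple.
From time T_n on, the sceneries at x are thus those at the n-th shifted point, with time translated
by `log (scale n ω)` (`scenery_code`). Hence the integral of g(μ_{x,t}) over [T_0, T_n] is the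
Birkhoff sum of the same integral over [T_0, T_1] (`integral_scenery_eq_birkhoffSum`).

Birkhoff's theorem, applied to both sums, gives T_n/n → θ = ∫(T_1 - T_0) and (1/n)∫_0^{T_n}
g(μ_{x,t}) dt → J. Uniform contraction gives T_n ≥ cn with c > 0, so θ > 0. As g is bounded and T_n
grows linearly, averages over [0, T] converge to J/θ for continuous T
(`tendsto_average_of_tendsto_sequence`). A countable dense set of g gives one null set for all g.

The delicate point is `eq_map_code`: closed cylinders may share endpoints, so it is not immediate
that their masses determine `μ`. -/

/-! ### The pointwise ergodic theorem -/

section Birkhoff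

variable {X : Type*} {T : X → X} {f : X → ℝ}

/-- The running maximum `max (0, S₁ f, …, S_n f)` of the Birkhoff sums of `f`. -/
noncomputable def birkhoffMax (T : X → X) (f : X → ℝ) : ℕ → X → ℝ
  | 0, _ => 0
  | n + 1, x => max 0 (f x + birkhoffMax T f n (T x))

theorem birkhoffMax_nonneg (n : ℕ) (x : X) : 0 ≤ birkhoffMax T f n x := by
  cases n with
  | zero => exact le_rfl
  | succ n => exact le_max_left _ _

theorem birkhoffMax_le_succ (n : ℕ) : ∀ x : X, birkhoffMax T f n x ≤ birkhoffMax T f (n + 1) x := by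
  induction n with
  | zero => exact fun x => birkhoffMax_nonneg 1 x
  | succ n ih => exact fun x => max_le_max le_rfl (add_le_add le_rfl (ih (T x)))

theorem birkhoffSum_le_birkhoffMax (n : ℕ) :
    ∀ x : X, birkhoffSum T f n x ≤ birkhoffMax T f n x := by
  induction n with
  | zero => intro x; simp [birkhoffMax]
  | succ n ih =>
    intro x
    rw [birkhoffSum_succ']
    exact (add_le_add le_rfl (ih (T x))).trans (le_max_right _ _)

variable [MeasurableSpace X] {μ : Measure X}

theorem measurable_birkhoffMax (hT : Measurable T) (hf : Measurable f) (n : ℕ) :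
    Measurable (birkhoffMax T f n) := by
  induction n with
  | zero => exact measurable_const
  | succ n ih => exact measurable_const.max (hf.add (ih.comp hT))

theorem integrable_birkhoffMax (hT : MeasurePreserving T μ μ) (hf : Integrable f μ) (n : ℕ) :
    Integrable (birkhoffMax T f n) μ := by
  induction n with
  | zero => exact integrable_zero X ℝ μ
  | succ n ih =>
    exact (integrable_zero X ℝ μ).sup (hf.add (hT.integrable_comp_of_integrable ih))

theorem MeasureTheory.MeasurePreserving.integral_comp_of_aestronglyMeasurable
    (hT : MeasurePreserving T μ μ) {g : X → ℝ} (hg : AEStronglyMeasurable g μ) :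
    ∫ x, g (T x) ∂μ = ∫ x, g x ∂μ := by
  have h := integral_map (μ := μ) (φ := T) hT.measurable.aemeasurable (f := g)
    (by rw [hT.map_eq]; exact hg)
  rw [hT.map_eq] at h
  exact h.symm

/-- A consequence of the maximal ergodic theorem: if the Birkhoff sums of `f` are unbounded above
on a set of positive measure, then the integral of `f` is nonnegative. -/
theorem Ergodic.ae_bddAbove_birkhoffSum [IsProbabilityMeasure μ] (hT : Ergodic T μ)
    (hfm : Measurable f) (hf : Integrable f μ) (hneg : ∫ x, f x ∂μ < 0) :
    ∀ᵐ x ∂μ, ∃ C : ℝ, ∀ n, birkhoffSum T f n x ≤ C := by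
  have hmp := hT.toMeasurePreserving
  set A : Set X := {x | ∃ C : ℕ, ∀ n, birkhoffMax T f n x ≤ C} with hA
  have hAm : MeasurableSet A := by
    have : A = ⋃ C : ℕ, ⋂ n, {x | birkhoffMax T f n x ≤ C} := by ext x; simp [hA]
    rw [this]
    exact .iUnion fun C => .iInter fun n =>
      measurableSet_le (measurable_birkhoffMax hT.measurable hfm n) measurable_const
  have hAT : T ⁻¹' A = A := by
    ext x
    constructor
    · rintro ⟨C, hC⟩
      obtain ⟨D, hD⟩ := exists_nat_ge (max 0 (f x + C))
      refine ⟨D, fun n => ?_⟩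
      cases n with
      | zero => exact Nat.cast_nonneg D
      | succ n => exact (max_le_max le_rfl (add_le_add le_rfl (hC n))).trans hD
    · rintro ⟨C, hC⟩
      obtain ⟨D, hD⟩ := exists_nat_ge (C - f x)
      refine ⟨D, fun n => ?_⟩
      have h1 : f x + birkhoffMax T f n (T x) ≤ C := (le_max_right _ _).trans (hC (n + 1))
      linarith
  have key : ∀ᵐ x ∂μ, x ∈ A := by
    refine (hT.toPreErgodic.ae_mem_or_ae_notMem hAm hAT).resolve_right fun hcon => ?_
    have hM : ∀ n, Integrable (birkhoffMax T f n) μ := integrable_birkhoffMax hmp hf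
    have hMT : ∀ n, Integrable (fun x => birkhoffMax T f n (T x)) μ := fun n =>
      hmp.integrable_comp_of_integrable (hM n)
    -- If the maxima are unbounded at T x, then M_{n+1}(x) - M_n(T x) = f(x) for large n; the
    -- difference always lies between -|f x| and |f x|.
    have hlim : Tendsto (fun n => ∫ x, (birkhoffMax T f (n + 1) x - birkhoffMax T f n (T x)) ∂μ)
        atTop (𝓝 (∫ x, f x ∂μ)) := by
      refine tendsto_integral_of_dominated_convergence (fun x => |f x|)
        (fun n => ((hM (n + 1)).sub (hMT n)).aestronglyMeasurable) hf.abs ?_ ?_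
      · refine fun n => .of_forall fun x => ?_
        have h0 := birkhoffMax_nonneg (T := T) (f := f) n (T x)
        rw [Real.norm_eq_abs, abs_le]
        change _ ≤ max 0 (f x + birkhoffMax T f n (T x)) - _ ∧
          max 0 (f x + birkhoffMax T f n (T x)) - _ ≤ _
        have h1 := le_max_right 0 (f x + birkhoffMax T f n (T x))
        have h2 := neg_abs_le (f x)
        refine ⟨by linarith, ?_⟩
        rw [sub_le_iff_le_add]
        exact max_le (add_nonneg (abs_nonneg _) h0) (add_le_add (le_abs_self _) le_rfl)
      · filter_upwards [hcon] with x hx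
        have hx' : T x ∉ A := by rw [← hAT] at hx; exact hx
        obtain ⟨C, hC⟩ := exists_nat_ge (-f x)
        have : ∃ N, (C : ℝ) < birkhoffMax T f N (T x) := by
          by_contra! hcon'
          exact hx' ⟨C, hcon'⟩
        obtain ⟨N, hN⟩ := this
        refine tendsto_const_nhds.congr' ?_
        filter_upwards [eventually_ge_atTop N] with n hn
        have hmono : birkhoffMax T f N (T x) ≤ birkhoffMax T f n (T x) :=
          monotone_nat_of_le_succ (f := fun n => birkhoffMax T f n (T x))
            (fun n => birkhoffMax_le_succ n (T x)) hn
        change f x = max 0 (f x + birkhoffMax T f n (T x)) - _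
        rw [max_eq_right (by linarith)]
        ring
    -- By invariance the integral equals ∫(M_{n+1} - M_n), which is nonnegative by monotonicity,
    -- contradicting ∫ f < 0 in the limit.
    have hnn : ∀ n, 0 ≤ ∫ x, (birkhoffMax T f (n + 1) x - birkhoffMax T f n (T x)) ∂μ := by
      intro n
      rw [integral_sub (hM _) (hMT n),
        hmp.integral_comp_of_aestronglyMeasurable (hM n).aestronglyMeasurable, sub_nonneg]
      exact integral_mono (hM n) (hM (n + 1)) (birkhoffMax_le_succ n)
    exact absurd (ge_of_tendsto' hlim hnn) (not_le.2 hneg)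
  filter_upwards [key] with x ⟨C, hC⟩
  exact ⟨C, fun n => (birkhoffSum_le_birkhoffMax n x).trans (hC n)⟩

/-- For ∫ f < d < c the Birkhoff sums of f - d are bounded above, so those of f are at most nd + C.
-/
theorem Ergodic.ae_eventually_birkhoffSum_div_lt [IsProbabilityMeasure μ] (hT : Ergodic T μ)
    (hfm : Measurable f) (hf : Integrable f μ) {c : ℝ} (hc : ∫ x, f x ∂μ < c) :
    ∀ᵐ x ∂μ, ∀ᶠ n : ℕ in atTop, birkhoffSum T f n x / n < c := by
  obtain ⟨d, hd, hdc⟩ := exists_between hc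
  have hneg : ∫ x, (f x - d) ∂μ < 0 := by
    rw [integral_sub hf (integrable_const d)]
    simpa using hd
  filter_upwards [hT.ae_bddAbove_birkhoffSum (hfm.sub_const d) (hf.sub (integrable_const d)) hneg]
    with x ⟨C, hC⟩
  have hsum : ∀ n : ℕ, birkhoffSum T f n x ≤ n * d + C := by
    intro n
    have h := hC n
    simp only [birkhoffSum, Finset.sum_sub_distrib, Finset.sum_const, Finset.card_range,
      nsmul_eq_mul] at h
    simp only [birkhoffSum]
    linarith
  have hlim : Tendsto (fun n : ℕ => C / (n : ℝ)) atTop (𝓝 0) :=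
    tendsto_const_div_atTop_nhds_zero_nat C
  filter_upwards [hlim.eventually (gt_mem_nhds (sub_pos.2 hdc)), eventually_gt_atTop 0]
    with n hn hn0
  have hn0' : (0 : ℝ) < n := by exact_mod_cast hn0
  have h := hsum n
  rw [div_lt_iff₀ hn0'] at hn ⊢
  linarith

/-- **Birkhoff's pointwise ergodic theorem** for ergodic maps of a probability space. -/
theorem Ergodic.ae_tendsto_birkhoffSum_div [IsProbabilityMeasure μ] (hT : Ergodic T μ)
    (hf : Integrable f μ) :
    ∀ᵐ x ∂μ, Tendsto (fun n : ℕ => birkhoffSum T f n x / n) atTop (𝓝 (∫ x, f x ∂μ)) := by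
  -- The maximal argument needs a measurable function; a general f agrees with its measurable
  -- representative along almost every orbit. Rational bounds keep the exceptional sets countable in
  -- number.
  have main : ∀ g : X → ℝ, Measurable g → Integrable g μ →
      ∀ᵐ x ∂μ, Tendsto (fun n : ℕ => birkhoffSum T g n x / n) atTop (𝓝 (∫ x, g x ∂μ)) := by
    intro g hgm hg
    have hup : ∀ q : ℚ, ∀ᵐ x ∂μ, ∫ x, g x ∂μ < q →
        ∀ᶠ n : ℕ in atTop, birkhoffSum T g n x / n < q := by
      intro q
      by_cases hq : ∫ x, g x ∂μ < q
      · filter_upwards [hT.ae_eventually_birkhoffSum_div_lt hgm hg hq] with x hx _ using hx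
      · exact .of_forall fun x h => absurd h hq
    have hlow : ∀ q : ℚ, ∀ᵐ x ∂μ, (q : ℝ) < ∫ x, g x ∂μ →
        ∀ᶠ n : ℕ in atTop, (q : ℝ) < birkhoffSum T g n x / n := by
      intro q
      by_cases hq : (q : ℝ) < ∫ x, g x ∂μ
      · have hq' : ∫ x, -g x ∂μ < -q := by rw [integral_neg]; linarith
        filter_upwards [hT.ae_eventually_birkhoffSum_div_lt hgm.neg hg.neg hq'] with x hx _
        filter_upwards [hx] with n hn
        have : birkhoffSum T (-g) n x = -birkhoffSum T g n x := by
          simp [birkhoffSum]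
        rw [this, neg_div] at hn
        linarith
      · exact .of_forall fun x h => absurd h hq
    filter_upwards [ae_all_iff.2 hup, ae_all_iff.2 hlow] with x h1 h2
    refine tendsto_order.2 ⟨fun a ha => ?_, fun a ha => ?_⟩
    · obtain ⟨q, hq1, hq2⟩ := exists_rat_btwn ha
      filter_upwards [h2 q hq2] with n hn using hq1.trans hn
    · obtain ⟨q, hq1, hq2⟩ := exists_rat_btwn ha
      filter_upwards [h1 q hq1] with n hn using hn.trans hq2
  have hfg := hf.aestronglyMeasurable.ae_eq_mk
  have hall : ∀ᵐ x ∂μ, ∀ n, f (T^[n] x) = hf.aestronglyMeasurable.mk f (T^[n] x) :=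
    ae_all_iff.2 fun n => (hT.toMeasurePreserving.iterate n).quasiMeasurePreserving.ae hfg
  filter_upwards [main _ hf.aestronglyMeasurable.stronglyMeasurable_mk.measurable
    (hf.congr hfg), hall] with x hx hx'
  rw [integral_congr_ae hfg]
  refine hx.congr fun n => ?_
  simp only [birkhoffSum, hx']

end Birkhoff

/-! ### Ergodicity of Bernoulli shifts -/

section BernoulliShift

variable {Λ : Type*}

/-- The left shift on sequences. -/
def seqShift (ω : ℕ → Λ) : ℕ → Λ := fun n => ω (n + 1)

theorem seqShift_iterate (n : ℕ) (ω : ℕ → Λ) (k : ℕ) : seqShift^[n] ω k = ω (k + n) := by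
  induction n generalizing ω with
  | zero => rfl
  | succ n ih => rw [Function.iterate_succ_apply, ih, seqShift, add_assoc]

variable [MeasurableSpace Λ]

theorem measurable_seqShift : Measurable (seqShift : (ℕ → Λ) → ℕ → Λ) := by
  unfold seqShift; fun_prop

/-- An invariant set equals its preimage under every iterate, so it depends only on the coordinates
from n on, for each n. It is a tail event, and the zero-one law applies. -/
theorem ergodic_seqShift (P : Measure Λ) [IsProbabilityMeasure P] :
    Ergodic seqShift (Measure.infinitePi fun _ : ℕ => P) where
  measurable := measurable_seqShift
  map_eq := Measure.map_infinitePi_infinitePi_of_inj (P := fun _ : ℕ => P)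
    (f := fun n : ℕ => n + 1) (add_left_injective 1)
  aeconst_set := by
    intro A hA hAT
    have hiter : ∀ n, seqShift^[n] ⁻¹' A = A := by
      intro n
      induction n with
      | zero => rfl
      | succ n ih => rw [Function.iterate_succ, Set.preimage_comp, ih, hAT]
    let s : ℕ → MeasurableSpace (ℕ → Λ) := fun n => MeasurableSpace.comap (fun ω => ω n) inferInstance
    have hind : ProbabilityTheory.iIndep s (Measure.infinitePi fun _ : ℕ => P) :=
      ProbabilityTheory.iIndepFun_infinitePi (P := fun _ : ℕ => P) (X := fun _ : ℕ => (id : Λ → Λ))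
        (fun _ => measurable_id)
    have htail : MeasurableSet[limsup s atTop] A := by
      rw [limsup_eq_iInf_iSup_of_nat, MeasurableSpace.measurableSet_iInf]
      intro n
      have hm : @Measurable _ _ (⨆ i ≥ n, s i) _ (seqShift^[n] : (ℕ → Λ) → ℕ → Λ) := by
        refine @measurable_pi_lambda _ _ _ (⨆ i ≥ n, s i) _ _ fun k => ?_
        have h1 : (fun ω : ℕ → Λ => seqShift^[n] ω k) = fun ω => ω (k + n) :=
          funext fun ω => seqShift_iterate n ω k
        rw [h1]
        exact (comap_measurable _).mono (le_iSup₂_of_le (k + n) (Nat.le_add_left n k) le_rfl) le_rfl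
      rw [← hiter n]
      exact hm hA
    have h01 := ProbabilityTheory.measure_zero_or_one_of_measurableSet_limsup_atTop
      (fun n => (measurable_pi_apply n).comap_le) hind htail
    rw [eventuallyConst_set']
    rcases h01 with h | h
    · exact Or.inl (ae_eq_empty.2 h)
    · exact Or.inr (ae_eq_univ.2 ((prob_compl_eq_zero_iff hA).2 h))

end BernoulliShift

/-! ### Coding of points by sequences of digits -/

namespace PiecewiseLinearShift

variable {Λ : Type*} (σ : PiecewiseLinearShift Λ)

/-- The midpoint of the basic interval `[l]`. -/
noncomputable def mid (l : Λ) : ℝ := (σ.left l + σ.right l) / 2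

/-- Half the length of the basic interval `[l]`. -/
noncomputable def rad (l : Λ) : ℝ := (σ.right l - σ.left l) / 2

theorem rad_pos (l : Λ) : 0 < σ.rad l := by
  have := σ.left_lt_right l
  unfold rad; linarith

theorem abs_mid_add_rad_le (l : Λ) : |σ.mid l| + σ.rad l ≤ 1 := by
  have h := (σ.left_lt_right l).le
  have h1 := (σ.subset_window l ⟨le_rfl, h⟩).1
  have h2 := (σ.subset_window l ⟨h, le_rfl⟩).2
  have : |σ.mid l| ≤ 1 - σ.rad l := by
    rw [abs_le]; unfold mid rad; constructor <;> linarith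
  linarith

theorem mem_Ioo_iff (l : Λ) (x : ℝ) :
    x ∈ Set.Ioo (σ.left l) (σ.right l) ↔ |x - σ.mid l| < σ.rad l := by
  rw [abs_lt, Set.mem_Ioo]; unfold mid rad
  constructor <;> rintro ⟨h1, h2⟩ <;> constructor <;> linarith

variable {σ} in
theorem OrientationPreserving.map_eq (hσ : σ.OrientationPreserving) {l : Λ} {x : ℝ}
    (hx : x ∈ Set.Ioo (σ.left l) (σ.right l)) : σ.map x = (x - σ.mid l) / σ.rad l := by
  obtain ⟨a, b, hab⟩ := σ.linear l
  have hr := σ.rad_pos l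
  have ha : 0 < a := by
    have hm : σ.mid l ∈ Set.Ioo (σ.left l) (σ.right l) := by
      rw [mem_Ioo_iff]; simpa using hr
    have hm' : σ.mid l + σ.rad l / 2 ∈ Set.Ioo (σ.left l) (σ.right l) := by
      rw [mem_Ioo_iff, add_sub_cancel_left, abs_of_pos (by linarith)]; linarith
    have h := hσ l hm hm' (by linarith)
    rw [hab _ hm, hab _ hm'] at h
    have : 0 < a * (σ.rad l / 2) := by linarith
    exact pos_of_mul_pos_left this (by linarith)
  -- Comparing infima and suprema of the two open intervals determines a and b.
  have himg : Set.Ioo (a * σ.left l + b) (a * σ.right l + b) = Set.Ioo (-1) 1 := by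
    rw [← σ.image_interior l, Set.image_congr (hab)]
    exact (Set.image_affine_Ioo ha _ _ _).symm
  have hlt : a * σ.left l + b < a * σ.right l + b := by
    have := mul_lt_mul_of_pos_left (σ.left_lt_right l) ha; linarith
  have h1 : a * σ.left l + b = -1 := by
    rw [← csInf_Ioo hlt, himg, csInf_Ioo (by norm_num)]
  have h2 : a * σ.right l + b = 1 := by
    rw [← csSup_Ioo hlt, himg, csSup_Ioo (by norm_num)]
  have h3 : a * σ.rad l = 1 := by unfold rad; linarith
  have h4 : a * σ.mid l + b = 0 := by unfold mid; linarith
  rw [hab x hx, eq_div_iff hr.ne']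
  linear_combination (x - σ.mid l) * h3 + σ.rad l * h4

variable {σ} in
-- The slope on `[l]` is `1 / rad l`, so the expansion constant bounds all radii at once, even for
-- infinite `Λ`.
theorem OrientationPreserving.exists_rad_le (hσ : σ.OrientationPreserving) :
    ∃ κ : ℝ, 0 < κ ∧ κ < 1 ∧ ∀ l, σ.rad l ≤ κ := by
  obtain ⟨c, hc, h⟩ := σ.expanding
  refine ⟨c⁻¹, by positivity, inv_lt_one_of_one_lt₀ hc, fun l => ?_⟩
  have hr := σ.rad_pos l
  have hm : σ.mid l ∈ Set.Ioo (σ.left l) (σ.right l) := by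
    rw [mem_Ioo_iff]; simpa using hr
  have hm' : σ.mid l + σ.rad l / 2 ∈ Set.Ioo (σ.left l) (σ.right l) := by
    rw [mem_Ioo_iff, add_sub_cancel_left, abs_of_pos (by linarith)]; linarith
  have := h l _ hm' _ hm
  rw [hσ.map_eq hm, hσ.map_eq hm', ← sub_div, abs_div, abs_of_pos hr] at this
  simp only [add_sub_cancel_left, sub_self, sub_zero, abs_of_pos (half_pos hr)] at this
  have h2 : σ.rad l / 2 / σ.rad l = 1 / 2 := by field_simp
  rw [h2] at this
  rw [le_inv_comm₀ hr (by linarith), ← one_div, le_div_iff₀ hr]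
  linarith

/-- Half the length of the cylinder of generation `n` with digits `ω 0, …, ω (n - 1)`. -/
noncomputable def scale (n : ℕ) (ω : ℕ → Λ) : ℝ := ∏ i ∈ Finset.range n, σ.rad (ω i)

/-- The midpoint of the cylinder of generation `n` with digits `ω 0, …, ω (n - 1)`. -/
noncomputable def center (n : ℕ) (ω : ℕ → Λ) : ℝ :=
  ∑ i ∈ Finset.range n, σ.scale i ω * σ.mid (ω i)

@[simp] theorem scale_zero (ω : ℕ → Λ) : σ.scale 0 ω = 1 := by simp [scale]

@[simp] theorem center_zero (ω : ℕ → Λ) : σ.center 0 ω = 0 := by simp [center]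

theorem scale_succ (n : ℕ) (ω : ℕ → Λ) : σ.scale (n + 1) ω = σ.scale n ω * σ.rad (ω n) := by
  simp [scale, Finset.prod_range_succ]

theorem center_succ (n : ℕ) (ω : ℕ → Λ) :
    σ.center (n + 1) ω = σ.center n ω + σ.scale n ω * σ.mid (ω n) := by
  simp [center, Finset.sum_range_succ]

theorem scale_succ' (n : ℕ) (ω : ℕ → Λ) :
    σ.scale (n + 1) ω = σ.rad (ω 0) * σ.scale n (seqShift ω) := by
  simp [scale, Finset.prod_range_succ', seqShift, mul_comm]

theorem center_succ' (n : ℕ) (ω : ℕ → Λ) :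
    σ.center (n + 1) ω = σ.mid (ω 0) + σ.rad (ω 0) * σ.center n (seqShift ω) := by
  rw [center, Finset.sum_range_succ', scale_zero, one_mul, add_comm, center, Finset.mul_sum]
  simp only [scale_succ', mul_assoc]
  rfl

theorem scale_pos (n : ℕ) (ω : ℕ → Λ) : 0 < σ.scale n ω :=
  Finset.prod_pos fun _ _ => σ.rad_pos _

theorem scale_le_pow {κ : ℝ} (hκ : ∀ l, σ.rad l ≤ κ) (n : ℕ) (ω : ℕ → Λ) :
    σ.scale n ω ≤ κ ^ n := by
  have := Finset.prod_le_prod (s := Finset.range n) (fun i _ => (σ.rad_pos (ω i)).le)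
    (fun i _ => hκ (ω i))
  simpa [scale] using this

theorem abs_center_add_scale_le (n : ℕ) (ω : ℕ → Λ) : |σ.center n ω| + σ.scale n ω ≤ 1 := by
  induction n with
  | zero => simp
  | succ n ih =>
    rw [center_succ, scale_succ]
    have h1 := abs_add_le (σ.center n ω) (σ.scale n ω * σ.mid (ω n))
    rw [abs_mul, abs_of_pos (σ.scale_pos n ω)] at h1
    have h2 := mul_le_mul_of_nonneg_left (σ.abs_mid_add_rad_le (ω n)) (σ.scale_pos n ω).le
    linarith

theorem scale_congr {n : ℕ} {ω ω' : ℕ → Λ} (h : ∀ i < n, ω i = ω' i) :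
    σ.scale n ω = σ.scale n ω' :=
  Finset.prod_congr rfl fun i hi => by rw [h i (Finset.mem_range.1 hi)]

theorem center_congr {n : ℕ} {ω ω' : ℕ → Λ} (h : ∀ i < n, ω i = ω' i) :
    σ.center n ω = σ.center n ω' :=
  Finset.sum_congr rfl fun i hi => by
    have hi' := Finset.mem_range.1 hi
    rw [h i hi', σ.scale_congr fun j hj => h j (hj.trans hi')]

variable {σ} in
-- The two claims need a joint induction: the condition on the next digit is translated to x by the
-- affine formula for the n-th iterate, and that formula holds only on the open cylinder.
theorem OrientationPreserving.mem_and_iterate_map_eq (hσ : σ.OrientationPreserving)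
    (n : ℕ) (ω : ℕ → Λ) (x : ℝ) :
    ((|x| < 1 ∧ ∀ i < n, σ.map^[i] x ∈ Set.Ioo (σ.left (ω i)) (σ.right (ω i))) ↔
      |x - σ.center n ω| < σ.scale n ω) ∧
    (|x - σ.center n ω| < σ.scale n ω → σ.map^[n] x = (x - σ.center n ω) / σ.scale n ω) := by
  induction n with
  | zero => simp
  | succ n ih =>
    have hs := σ.scale_pos n ω
    have hr := σ.rad_pos (ω n)
    have hval : ∀ (_ : |x - σ.center n ω| < σ.scale n ω),
        (σ.map^[n] x ∈ Set.Ioo (σ.left (ω n)) (σ.right (ω n)) ↔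
          |x - σ.center (n + 1) ω| < σ.scale (n + 1) ω) := by
      intro h
      rw [ih.2 h, mem_Ioo_iff, center_succ, scale_succ,
        ← mul_lt_mul_iff_right₀ hs, ← abs_of_pos hs, ← abs_mul, abs_of_pos hs, mul_sub,
        mul_div_cancel₀ _ hs.ne', sub_sub]
    have hsub : |x - σ.center (n + 1) ω| < σ.scale (n + 1) ω → |x - σ.center n ω| < σ.scale n ω := by
      intro h
      rw [center_succ, scale_succ] at h
      have h1 := abs_add_le (x - (σ.center n ω + σ.scale n ω * σ.mid (ω n)))
        (σ.scale n ω * σ.mid (ω n))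
      rw [abs_mul, abs_of_pos hs] at h1
      have h2 := mul_le_mul_of_nonneg_left (σ.abs_mid_add_rad_le (ω n)) hs.le
      have h3 : x - (σ.center n ω + σ.scale n ω * σ.mid (ω n)) + σ.scale n ω * σ.mid (ω n) =
        x - σ.center n ω := by ring
      rw [h3] at h1
      linarith
    constructor
    · constructor
      · rintro ⟨h1, h2⟩
        exact (hval (ih.1.1 ⟨h1, fun i hi => h2 i (hi.trans n.lt_succ_self)⟩)).1
          (h2 n n.lt_succ_self)
      · intro h
        have h' := ih.1.2 (hsub h)
        refine ⟨h'.1, fun i hi => ?_⟩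
        rcases Nat.lt_succ_iff_lt_or_eq.1 hi with hi | rfl
        · exact h'.2 i hi
        · exact (hval (hsub h)).2 h
    · intro h
      rw [Function.iterate_succ_apply', hσ.map_eq ((hval (hsub h)).2 h), ih.2 (hsub h), center_succ,
        scale_succ]
      field_simp
      ring

variable {σ} in
/-- The cylinders are closed intervals. -/
theorem OrientationPreserving.cylinder_eq (hσ : σ.OrientationPreserving) (n : ℕ) (ω : ℕ → Λ) :
    σ.cylinder (fun i : Fin n => ω i) =
      Set.Icc (σ.center n ω - σ.scale n ω) (σ.center n ω + σ.scale n ω) := by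
  have hs := σ.scale_pos n ω
  -- Generation 0 starts from the closed window, not from |x| < 1; for n > 0 the first digit already
  -- forces |x| < 1.
  rcases Nat.eq_zero_or_pos n with rfl | hn
  · simp only [cylinder, center_zero, scale_zero, IsEmpty.forall_iff, and_true, zero_sub, zero_add]
    exact isClosed_Icc.closure_eq
  · rw [← closure_Ioo (by linarith), cylinder]
    congr 1
    ext x
    have hball : x ∈ Set.Ioo (σ.center n ω - σ.scale n ω) (σ.center n ω + σ.scale n ω) ↔
        |x - σ.center n ω| < σ.scale n ω := by
      rw [abs_lt, Set.mem_Ioo]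
      constructor <;> rintro ⟨h1, h2⟩ <;> constructor <;> linarith
    rw [hball, ← (hσ.mem_and_iterate_map_eq n ω x).1]
    constructor
    · rintro ⟨_, h⟩
      refine ⟨?_, fun i hi => h ⟨i, hi⟩⟩
      have h0 := (σ.mem_Ioo_iff _ _).1 (h ⟨0, hn⟩)
      have h1 := σ.abs_mid_add_rad_le (ω 0)
      have h2 := abs_add_le (x - σ.mid (ω 0)) (σ.mid (ω 0))
      simp only [Function.iterate_zero, id_eq, sub_add_cancel] at h0 h2
      linarith
    · rintro ⟨h1, h2⟩
      exact ⟨⟨(abs_lt.1 h1).1.le, (abs_lt.1 h1).2.le⟩, fun i => h2 i i.2⟩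

variable {σ} in
/-- The open cylinders for different words of the same length are disjoint. -/
theorem OrientationPreserving.eq_of_mem (hσ : σ.OrientationPreserving) {n : ℕ} {ω ω' : ℕ → Λ}
    {x : ℝ} (h : |x - σ.center n ω| < σ.scale n ω) (h' : |x - σ.center n ω'| < σ.scale n ω') :
    ∀ i < n, ω i = ω' i := by
  intro i hi
  have h1 := ((hσ.mem_and_iterate_map_eq n ω x).1.2 h).2 i hi
  have h2 := ((hσ.mem_and_iterate_map_eq n ω' x).1.2 h').2 i hi
  by_contra hne
  exact Set.disjoint_left.1 (σ.disjoint_interiors hne) h1 h2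

/-- The point with a given sequence of digits. -/
noncomputable def code (ω : ℕ → Λ) : ℝ := ∑' i, σ.scale i ω * σ.mid (ω i)

variable {σ} in
theorem OrientationPreserving.tendsto_center (hσ : σ.OrientationPreserving) (ω : ℕ → Λ) :
    Tendsto (fun n => σ.center n ω) atTop (𝓝 (σ.code ω)) := by
  obtain ⟨κ, h0, h1, hκ⟩ := hσ.exists_rad_le
  have hsum : Summable fun i => σ.scale i ω * σ.mid (ω i) := by
    refine Summable.of_norm_bounded (summable_geometric_of_lt_one h0.le h1) fun i => ?_
    rw [norm_mul, Real.norm_eq_abs, Real.norm_eq_abs, abs_of_pos (σ.scale_pos i ω)]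
    have hm : |σ.mid (ω i)| ≤ 1 := by
      linarith [σ.abs_mid_add_rad_le (ω i), σ.rad_pos (ω i)]
    calc σ.scale i ω * |σ.mid (ω i)| ≤ σ.scale i ω * 1 :=
          mul_le_mul_of_nonneg_left hm (σ.scale_pos i ω).le
      _ ≤ κ ^ i := by rw [mul_one]; exact σ.scale_le_pow hκ i ω
  exact hsum.hasSum.tendsto_sum_nat

variable {σ} in
theorem OrientationPreserving.abs_code_le (hσ : σ.OrientationPreserving) (ω : ℕ → Λ) :
    |σ.code ω| ≤ 1 :=
  le_of_tendsto' (hσ.tendsto_center ω).abs fun n => by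
    linarith [σ.abs_center_add_scale_le n ω, σ.scale_pos n ω]

variable {σ} in
theorem OrientationPreserving.code_eq' (hσ : σ.OrientationPreserving) (ω : ℕ → Λ) :
    σ.code ω = σ.mid (ω 0) + σ.rad (ω 0) * σ.code (seqShift ω) := by
  refine tendsto_nhds_unique ((tendsto_add_atTop_iff_nat 1).2 (hσ.tendsto_center ω)) ?_
  simp only [center_succ']
  exact ((hσ.tendsto_center (seqShift ω)).const_mul _).const_add _

variable {σ} in
theorem OrientationPreserving.code_eq (hσ : σ.OrientationPreserving) (n : ℕ) (ω : ℕ → Λ) :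
    σ.code ω = σ.center n ω + σ.scale n ω * σ.code (seqShift^[n] ω) := by
  induction n with
  | zero => simp
  | succ n ih =>
    rw [ih, hσ.code_eq' (seqShift^[n] ω), center_succ, scale_succ, seqShift_iterate, zero_add,
      Function.iterate_succ_apply']
    ring

variable {σ} in
theorem OrientationPreserving.abs_code_sub_center (hσ : σ.OrientationPreserving) (n : ℕ)
    (ω : ℕ → Λ) : |σ.code ω - σ.center n ω| = σ.scale n ω * |σ.code (seqShift^[n] ω)| := by
  rw [hσ.code_eq n ω, add_sub_cancel_left, abs_mul, abs_of_pos (σ.scale_pos n ω)]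

variable {σ} in
theorem OrientationPreserving.code_mem_cylinder (hσ : σ.OrientationPreserving) (n : ℕ)
    (ω : ℕ → Λ) : |σ.code ω - σ.center n ω| ≤ σ.scale n ω := by
  rw [hσ.abs_code_sub_center]
  exact mul_le_of_le_one_right (σ.scale_pos n ω).le (hσ.abs_code_le _)

variable {σ} in
-- The left side is the distance from the point to the boundary of its first cylinder, the right
-- side its distance to the boundary of the larger interval I. This makes entry times nondecreasing.
theorem OrientationPreserving.rad_mul_le (hσ : σ.OrientationPreserving) (ω : ℕ → Λ) :
    σ.rad (ω 0) * (1 - |σ.code (seqShift ω)|) ≤ 1 - |σ.code ω| := by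
  have h1 := abs_add_le (σ.mid (ω 0)) (σ.rad (ω 0) * σ.code (seqShift ω))
  rw [← hσ.code_eq', abs_mul, abs_of_pos (σ.rad_pos _)] at h1
  linarith [σ.abs_mid_add_rad_le (ω 0)]

theorem measurable_scale [MeasurableSpace Λ] [DiscreteMeasurableSpace Λ] (n : ℕ) :
    Measurable (σ.scale n) :=
  Finset.measurable_fun_prod _ fun i _ => (Measurable.of_discrete (f := σ.rad)).comp
    (measurable_pi_apply i)

theorem measurable_center [MeasurableSpace Λ] [DiscreteMeasurableSpace Λ] (n : ℕ) :
    Measurable (σ.center n) :=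
  Finset.measurable_fun_sum _ fun i _ => (σ.measurable_scale i).mul
    ((Measurable.of_discrete (f := σ.mid)).comp (measurable_pi_apply i))

variable {σ} in
theorem OrientationPreserving.measurable_code [MeasurableSpace Λ] [DiscreteMeasurableSpace Λ]
    (hσ : σ.OrientationPreserving) : Measurable σ.code :=
  measurable_of_tendsto_metrizable σ.measurable_center
    (tendsto_pi_nhds.2 hσ.tendsto_center)

end PiecewiseLinearShift

/-! ### Uniqueness of the Bernoulli measure -/

theorem exists_lt_one_forall_le {Λ : Type*} [Nontrivial Λ] {p : Λ → ℝ} (hp : ∀ l, 0 < p l)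
    (hp_sum : HasSum p 1) : ∃ ρ : ℝ, 0 ≤ ρ ∧ ρ < 1 ∧ ∀ l, p l ≤ ρ := by
  classical
  obtain ⟨a, b, hab⟩ := exists_pair_ne Λ
  have hpair : ∀ l m, l ≠ m → p l ≤ 1 - p m := by
    intro l m hlm
    have h := sum_le_hasSum {l, m} (fun i _ => (hp i).le) hp_sum
    rw [Finset.sum_pair hlm] at h
    linarith
  -- Every weight other than `p a` is at most `1 - p a`, and `p a` is at most `1 - p b`.
  refine ⟨max (1 - p a) (1 - p b), ?_, ?_, fun l => ?_⟩
  · exact (hp a).le.trans ((hpair a b hab).trans (le_max_right _ _))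
  · exact max_lt (by linarith [hp a]) (by linarith [hp b])
  · by_cases h : l = a
    · exact (hpair l b (h ▸ hab)).trans (le_max_right _ _)
    · exact (hpair l a h).trans (le_max_left _ _)

section Sequences

variable {Λ : Type*}

/-- Extension of a finite word to an infinite sequence. -/
noncomputable def wordExtend [Nonempty Λ] {n : ℕ} (w : Fin n → Λ) (i : ℕ) : Λ :=
  if h : i < n then w ⟨i, h⟩ else Classical.arbitrary Λ

@[simp] theorem wordExtend_apply [Nonempty Λ] {n : ℕ} (w : Fin n → Λ) (i : Fin n) :
    wordExtend w i = w i := by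
  simp [wordExtend]

/-- The sequence obtained from `ω` by putting the digit `l` in front. -/
def seqCons (l : Λ) (ω : ℕ → Λ) : ℕ → Λ
  | 0 => l
  | n + 1 => ω n

@[simp] theorem seqCons_zero (l : Λ) (ω : ℕ → Λ) : seqCons l ω 0 = l := rfl

@[simp] theorem seqShift_seqCons (l : Λ) (ω : ℕ → Λ) : seqShift (seqCons l ω) = ω := rfl

theorem infinitePi_cylinder_eq [MeasurableSpace Λ] [DiscreteMeasurableSpace Λ] {p : Λ → ℝ}
    (hp : ∀ l, 0 < p l) {P : Measure Λ} [IsProbabilityMeasure P]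
    (hP : ∀ l, P {l} = ENNReal.ofReal (p l)) (n : ℕ) (ω : ℕ → Λ) :
    Measure.infinitePi (fun _ : ℕ => P) {ω' | ∀ i < n, ω' i = ω i} =
      ENNReal.ofReal (∏ i : Fin n, p (ω i)) := by
  have h : {ω' : ℕ → Λ | ∀ i < n, ω' i = ω i} =
      Set.pi (Finset.range n : Finset ℕ) fun i => {ω i} := by
    ext ω'; simp
  rw [h, Measure.infinitePi_pi _ fun i _ => MeasurableSet.of_discrete,
    ENNReal.ofReal_prod_of_nonneg fun i _ => (hp _).le, Finset.prod_range]
  simp [hP]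

end Sequences

namespace PiecewiseLinearShift

variable {Λ : Type*} {σ : PiecewiseLinearShift Λ}

/-- Half-open intervals with a common point also share points just to its right, which lie in both
open cylinders. -/
theorem OrientationPreserving.eq_of_mem_Ico (hσ : σ.OrientationPreserving) {n : ℕ} {ω ω' : ℕ → Λ}
    {x : ℝ} (h : x ∈ Set.Ico (σ.center n ω - σ.scale n ω) (σ.center n ω + σ.scale n ω))
    (h' : x ∈ Set.Ico (σ.center n ω' - σ.scale n ω') (σ.center n ω' + σ.scale n ω')) :
    ∀ i < n, ω i = ω' i := by
  obtain ⟨y, hy, hy'⟩ := exists_between (lt_min h.2 h'.2)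
  obtain ⟨h1, h2⟩ := lt_min_iff.1 hy'
  refine hσ.eq_of_mem (x := y) (abs_lt.2 ⟨?_, ?_⟩) (abs_lt.2 ⟨?_, ?_⟩) <;>
    linarith [h.1, h'.1]

theorem OrientationPreserving.eq_of_mem_Ioc (hσ : σ.OrientationPreserving) {n : ℕ} {ω ω' : ℕ → Λ}
    {x : ℝ} (h : x ∈ Set.Ioc (σ.center n ω - σ.scale n ω) (σ.center n ω + σ.scale n ω))
    (h' : x ∈ Set.Ioc (σ.center n ω' - σ.scale n ω') (σ.center n ω' + σ.scale n ω')) :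
    ∀ i < n, ω i = ω' i := by
  obtain ⟨y, hy, hy'⟩ := exists_between (max_lt h.1 h'.1)
  obtain ⟨h1, h2⟩ := max_lt_iff.1 hy
  refine hσ.eq_of_mem (x := y) (abs_lt.2 ⟨?_, ?_⟩) (abs_lt.2 ⟨?_, ?_⟩) <;>
    linarith [h.2, h'.2]

variable [MeasurableSpace Λ] [DiscreteMeasurableSpace Λ] {p : Λ → ℝ} {P : Measure Λ}
  [IsProbabilityMeasure P]

/-- A point lies in at most two closed cylinders of generation n, one containing it in its `Ico` and
one in its `Ioc`. Each has mass at most ρ^n with ρ < 1. -/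
theorem OrientationPreserving.noAtoms_map_code [Nontrivial Λ] (hσ : σ.OrientationPreserving)
    (hp : ∀ l, 0 < p l) (hp_sum : HasSum p 1) (hP : ∀ l, P {l} = ENNReal.ofReal (p l)) :
    NullSingletonClass ((Measure.infinitePi fun _ : ℕ => P).map σ.code) := by
  refine ⟨fun x => ?_⟩
  obtain ⟨ρ, h0, h1, hρ⟩ := exists_lt_one_forall_le hp hp_sum
  rw [Measure.map_apply hσ.measurable_code (measurableSet_singleton x)]
  set ν := Measure.infinitePi fun _ : ℕ => P
  have hword : ∀ (n : ℕ) (s : Set (ℕ → Λ)), (∀ ω ∈ s, ∀ ω' ∈ s, ∀ i < n, ω i = ω' i) →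
      ν s ≤ ENNReal.ofReal (ρ ^ n) := by
    intro n s hs
    rcases s.eq_empty_or_nonempty with rfl | ⟨ω, hω⟩
    · simp
    · have hsub : s ⊆ {ω' | ∀ i < n, ω' i = ω i} := fun ω' hω' => hs ω' hω' ω hω
      refine (measure_mono hsub).trans ?_
      rw [infinitePi_cylinder_eq hp hP]
      refine ENNReal.ofReal_le_ofReal ?_
      have := Finset.prod_le_prod (s := Finset.univ) (fun (i : Fin n) _ => (hp (ω i)).le)
        (fun i _ => hρ (ω i))
      simpa using this
  have hle : ∀ n, ν (σ.code ⁻¹' {x}) ≤ ENNReal.ofReal (ρ ^ n) + ENNReal.ofReal (ρ ^ n) := by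
    intro n
    refine (measure_mono (t := {ω | x ∈ Set.Ico (σ.center n ω - σ.scale n ω)
      (σ.center n ω + σ.scale n ω)} ∪ {ω | x ∈ Set.Ioc (σ.center n ω - σ.scale n ω)
      (σ.center n ω + σ.scale n ω)}) ?_).trans ((measure_union_le _ _).trans (add_le_add
        (hword n _ fun ω h ω' h' => hσ.eq_of_mem_Ico h h')
        (hword n _ fun ω h ω' h' => hσ.eq_of_mem_Ioc h h')))
    rintro ω rfl
    have hm := abs_le.1 (hσ.code_mem_cylinder n ω)
    have hs := σ.scale_pos n ω
    rcases lt_or_ge (σ.code ω) (σ.center n ω + σ.scale n ω) with h | h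
    · exact Or.inl ⟨by linarith, h⟩
    · exact Or.inr ⟨by linarith, by linarith⟩
  have hlim : Tendsto (fun n : ℕ => ENNReal.ofReal (ρ ^ n) + ENNReal.ofReal (ρ ^ n)) atTop
      (𝓝 0) := by
    have := ENNReal.tendsto_ofReal (tendsto_pow_atTop_nhds_zero_of_lt_one h0 h1)
    simpa using this.add this
  exact le_antisymm (ge_of_tendsto' hlim hle) zero_le

/-- The Bernoulli measure is the distribution of the point whose digits are independent. -/
theorem OrientationPreserving.eq_map_code [Countable Λ] [Nontrivial Λ]
    (hσ : σ.OrientationPreserving)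
    (hp : ∀ l, 0 < p l) (hp_sum : HasSum p 1) (hP : ∀ l, P {l} = ENNReal.ofReal (p l))
    {μ : Measure ℝ} [IsProbabilityMeasure μ] (hμ : σ.IsBernoulli p μ) :
    (Measure.infinitePi fun _ : ℕ => P).map σ.code = μ := by
  have hna := hσ.noAtoms_map_code hp hp_sum hP
  set ν := Measure.infinitePi fun _ : ℕ => P with hν
  have : IsProbabilityMeasure (ν.map σ.code) :=
    Measure.isProbabilityMeasure_map hσ.measurable_code.aemeasurable
  obtain ⟨κ, hκ0, hκ1, hκ⟩ := hσ.exists_rad_le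
  -- The right endpoints of all cylinders. A priori `μ` may charge them, and then summing over
  -- closed cylinders counts them twice; the term `μ.restrict E` pays for this.
  let E : Set ℝ := ⋃ n : ℕ, Set.range fun w : Fin n → Λ =>
    σ.center n (wordExtend w) + σ.scale n (wordExtend w)
  have hE : E.Countable := Set.countable_iUnion fun n => Set.countable_range _
  have hclosed : ∀ K : Set ℝ, IsClosed K → ν.map σ.code K ≤ (μ + μ.restrict E) K := by
    intro K hK
    have hstep : ∀ n : ℕ, ν.map σ.code K ≤
        (μ + μ.restrict E) (Metric.cthickening (2 * κ ^ n) K) := by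
      intro n
      let c : (Fin n → Λ) → ℝ := fun w => σ.center n (wordExtend w)
      let r : (Fin n → Λ) → ℝ := fun w => σ.scale n (wordExtend w)
      -- Words whose cylinder meets K. These cylinders have length at most 2κ^n, hence stay in a
      -- thickening of K that shrinks to K.
      let S : Set (Fin n → Λ) := {w | (Set.Icc (c w - r w) (c w + r w) ∩ K).Nonempty}
      have hthick : ∀ w ∈ S, Set.Icc (c w - r w) (c w + r w) ⊆ Metric.cthickening (2 * κ ^ n) K := by
        rintro w ⟨y, hy, hyK⟩ z hz
        refine Metric.mem_cthickening_of_dist_le z y _ K hyK ?_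
        have := σ.scale_le_pow hκ n (wordExtend w)
        rw [Real.dist_eq, abs_le]
        have h1 : r w ≤ κ ^ n := this
        constructor <;> linarith [hz.1, hz.2, hy.1, hy.2]
      have hdisj : ∀ I : (Fin n → Λ) → Set ℝ,
          (∀ w w' x, x ∈ I w → x ∈ I w' → ∀ i < n, wordExtend w i = wordExtend w' i) →
          Pairwise fun w w' : S => Disjoint (I w) (I w') := by
        intro I hI w w' hww'
        refine Set.disjoint_left.2 fun x hx hx' => hww' (Subtype.ext (funext fun i => ?_))
        simpa using hI w w' x hx hx' i i.2
      calc ν.map σ.code K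
          ≤ ν (⋃ w : S, {ω' | ∀ i < n, ω' i = wordExtend (w : Fin n → Λ) i}) := by
            rw [Measure.map_apply hσ.measurable_code hK.measurableSet]
            refine measure_mono fun ω hω => ?_
            have hagree : ∀ i < n, ω i = wordExtend (fun i : Fin n => ω i) i := fun i hi => by
              simp [wordExtend, hi]
            refine Set.mem_iUnion.2 ⟨⟨fun i : Fin n => ω i, σ.code ω, ?_, hω⟩, hagree⟩
            have hm := abs_le.1 (hσ.code_mem_cylinder n ω)
            rw [σ.center_congr hagree, σ.scale_congr hagree] at hm
            constructor <;> simp only [c, r] <;> linarith [hm.1, hm.2]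
        _ ≤ ∑' w : S, ν {ω' | ∀ i < n, ω' i = wordExtend (w : Fin n → Λ) i} :=
            measure_iUnion_le _
        _ = ∑' w : S, μ (Set.Icc (c w - r w) (c w + r w)) := by
            refine tsum_congr fun w => ?_
            rw [hν, infinitePi_cylinder_eq hp hP, ← hσ.cylinder_eq, hμ]
        -- Splitting off the right endpoint leaves two families that are each pairwise disjoint, so
        -- the sums become measures of unions.
        _ ≤ ∑' w : S, (μ (Set.Ico (c w - r w) (c w + r w)) +
              μ.restrict E (Set.Ioc (c w - r w) (c w + r w))) := by
            refine ENNReal.tsum_le_tsum fun w => ?_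
            have hr : 0 < r w := σ.scale_pos _ _
            rw [Measure.restrict_apply measurableSet_Ioc]
            refine (measure_mono fun x hx => ?_).trans (measure_union_le _ _)
            rcases hx.2.lt_or_eq with h | h
            · exact Or.inl ⟨hx.1, h⟩
            · exact Or.inr ⟨⟨by linarith, h.le⟩, Set.mem_iUnion.2 ⟨n, w, h.symm⟩⟩
        _ = μ (⋃ w : S, Set.Ico (c w - r w) (c w + r w)) +
              μ.restrict E (⋃ w : S, Set.Ioc (c w - r w) (c w + r w)) := by
            rw [ENNReal.tsum_add, measure_iUnion
              (hdisj _ fun w w' x h h' => hσ.eq_of_mem_Ico h h') fun _ => measurableSet_Ico,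
              measure_iUnion
              (hdisj _ fun w w' x h h' => hσ.eq_of_mem_Ioc h h') fun _ => measurableSet_Ioc]
        _ ≤ _ := by
            rw [Measure.add_apply]
            refine add_le_add (measure_mono ?_) (measure_mono ?_)
            · exact Set.iUnion_subset fun w => Set.Ico_subset_Icc_self.trans (hthick w w.2)
            · exact Set.iUnion_subset fun w => Set.Ioc_subset_Icc_self.trans (hthick w w.2)
    have hpow : Tendsto (fun n : ℕ => 2 * κ ^ n) atTop (𝓝 0) := by
      simpa using (tendsto_pow_atTop_nhds_zero_of_lt_one hκ0.le hκ1).const_mul 2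
    exact ge_of_tendsto' ((tendsto_measure_cthickening_of_isClosed
      ⟨1, one_pos, measure_ne_top _ _⟩ hK).comp hpow) hstep
  have hle : ν.map σ.code ≤ μ + μ.restrict E := by
    refine Measure.le_iff.2 fun A hA => ?_
    rw [hA.measure_eq_iSup_isClosed_of_ne_top (measure_ne_top _ _)]
    exact iSup₂_le fun K hKA => iSup_le fun hK => (hclosed K hK).trans (measure_mono hKA)
  refine Measure.eq_of_le_of_isProbabilityMeasure (Measure.le_iff.2 fun A hA => ?_)
  -- The image measure has no atoms, so the countable set `E` can be discarded, and off `E` the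
  -- extra term vanishes.
  rw [← measure_sdiff_null (hE.measure_zero (ν.map σ.code))]
  refine (hle (A \ E)).trans ?_
  rw [Measure.add_apply, Measure.restrict_apply (hA.diff hE.measurableSet), Set.sdiff_inter_self,
    measure_empty, add_zero]
  exact measure_mono Set.sdiff_subset

/-- The Bernoulli measure is self-similar. -/
theorem OrientationPreserving.measure_affine_image [Countable Λ] [Nontrivial Λ]
    (hσ : σ.OrientationPreserving) (hp : ∀ l, 0 < p l) (hp_sum : HasSum p 1)
    (hP : ∀ l, P {l} = ENNReal.ofReal (p l))
    {μ : Measure ℝ} [IsProbabilityMeasure μ] (hμ : σ.IsBernoulli p μ) (l : Λ) {S : Set ℝ}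
    (hS : MeasurableSet S) (hSI : S ⊆ unitWindow) :
    μ ((fun y => σ.rad l * y + σ.mid l) '' S) = ENNReal.ofReal (p l) * μ S := by
  set φ : ℝ → ℝ := fun y => σ.rad l * y + σ.mid l with hφ
  have hφm : MeasurableEmbedding φ :=
    (measurableEmbedding_addRight _).comp (measurableEmbedding_mulLeft₀ (σ.rad_pos l).ne')
  have hpl0 : ENNReal.ofReal (p l) ≠ 0 := by simpa using hp l
  have himg : ∀ (n : ℕ) (ω : ℕ → Λ), φ '' σ.cylinder (fun i : Fin n => ω i) =
      σ.cylinder (fun i : Fin (n + 1) => seqCons l ω i) := by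
    intro n ω
    rw [hσ.cylinder_eq, hσ.cylinder_eq, hφ, Set.image_affine_Icc' (σ.rad_pos l), center_succ',
      scale_succ', seqShift_seqCons, seqCons_zero]
    congr 1 <;> ring
  -- The rescaled restriction of `μ` to `[l]` is again Bernoulli with weights `p`, so uniqueness
  -- identifies it with `μ`.
  set μ' : Measure ℝ := (ENNReal.ofReal (p l))⁻¹ • (μ.comap φ).restrict unitWindow with hμ'
  have happ : ∀ A : Set ℝ, MeasurableSet A → A ⊆ unitWindow →
      μ' A = (ENNReal.ofReal (p l))⁻¹ * μ (φ '' A) := by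
    intro A hA hAI
    rw [hμ', Measure.smul_apply, Measure.restrict_apply hA, Set.inter_eq_left.2 hAI,
      hφm.comap_apply, smul_eq_mul]
  have hcyl : ∀ (n : ℕ) (ω : ℕ → Λ), μ' (σ.cylinder (fun i : Fin n => ω i)) =
      ENNReal.ofReal (∏ i : Fin n, p (ω i)) := by
    intro n ω
    rw [happ (σ.cylinder fun i : Fin n => ω i) isClosed_closure.measurableSet, himg, hμ, Fin.prod_univ_succ]
    · simp only [Fin.val_zero, seqCons_zero, Fin.val_succ]
      rw [ENNReal.ofReal_mul (hp l).le, ← mul_assoc,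
        ENNReal.inv_mul_cancel hpl0 ENNReal.ofReal_ne_top, one_mul]
      rfl
    · exact closure_minimal (fun x hx => hx.1) isClosed_Icc
  have hunit : ∀ ω : ℕ → Λ, σ.cylinder (fun i : Fin 0 => ω i) = unitWindow := by
    intro ω; rw [hσ.cylinder_eq]; simp
  have hprob : IsProbabilityMeasure μ' := by
    refine ⟨?_⟩
    have h := hcyl 0 fun _ => l
    rw [hunit fun _ => l] at h
    rw [hμ', Measure.smul_apply, Measure.restrict_apply_univ]
    rw [hμ', Measure.smul_apply, Measure.restrict_apply_self] at h
    simpa using h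
  have hb : σ.IsBernoulli p μ' := by
    intro n w
    have := hcyl n (wordExtend w)
    simpa using this
  have h1 : μ' = μ := by
    rw [← hσ.eq_map_code hp hp_sum hP hb, hσ.eq_map_code hp hp_sum hP hμ]
  rw [← h1, happ S hS hSI, h1, ← mul_assoc, ENNReal.mul_inv_cancel hpl0 ENNReal.ofReal_ne_top,
    one_mul]

end PiecewiseLinearShift

/-! ### Windows and sceneries -/

theorem window_eq_Icc (x t : ℝ) :
    window x t = Set.Icc (x - Real.exp (-t)) (x + Real.exp (-t)) := by
  have h : zoom x t = (fun y : ℝ => Real.exp (-t) * y + x) ∘ Subtype.val := by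
    funext a; simp [zoom, add_comm]
  rw [window, h, Set.range_comp, Subtype.range_coe, Set.image_affine_Icc' (Real.exp_pos _)]
  congr 1 <;> ring

theorem window_subset_unitWindow {y s : ℝ} (h : Real.exp (-s) ≤ 1 - |y|) :
    window y s ⊆ unitWindow := by
  rw [window_eq_Icc]
  exact Set.Icc_subset_Icc (by linarith [neg_abs_le y]) (by linarith [le_abs_self y])

theorem measure_window_ne_zero {μ : Measure ℝ} {x : ℝ} (hx : x ∈ μ.support) (t : ℝ) :
    μ (window x t) ≠ 0 := by
  have he := Real.exp_pos (-t)
  refine ((Measure.mem_support_iff_forall x).1 hx _ ?_).ne'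
  rw [window_eq_Icc]
  exact Icc_mem_nhds (by linarith) (by linarith)

theorem rawSceneryFinite_ne_zero {μ : Measure ℝ} [IsLocallyFiniteMeasure μ] {x t : ℝ}
    (h : μ (window x t) ≠ 0) : rawSceneryFinite μ x t ≠ 0 := by
  intro h0
  have h1 : rawScenery μ x t = 0 :=
    congrArg (fun ν : FiniteMeasure unitWindow => (ν : Measure unitWindow)) h0
  apply h
  rw [window, ← Set.image_univ, ← rawScenery_apply, h1, Measure.coe_zero, Pi.zero_apply]

theorem MeasureTheory.FiniteMeasure.normalize_eq_of_eq_smul {Ω : Type*} [Nonempty Ω]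
    [MeasurableSpace Ω] {α β : FiniteMeasure Ω} {c : ℝ≥0∞} (hc0 : c ≠ 0) (hc : c ≠ ∞)
    (h : (α : Measure Ω) = c • (β : Measure Ω)) : α.normalize = β.normalize := by
  by_cases hβ : β = 0
  · have : α = 0 := FiniteMeasure.toMeasure_injective (by rw [h, hβ]; exact smul_zero c)
    rw [this, hβ]
  · have hα : α ≠ 0 := by
      rintro rfl
      apply hβ
      refine Subtype.ext (Measure.measure_univ_eq_zero.1 ?_)
      have h1 := congrArg (fun m : Measure Ω => m Set.univ) h
      simp only [Measure.smul_apply, smul_eq_mul] at h1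
      exact (mul_eq_zero.1 h1.symm).resolve_left hc0
    have hm : ((α.mass : NNReal) : ℝ≥0∞) = c * β.mass := by
      rw [FiniteMeasure.ennreal_mass, FiniteMeasure.ennreal_mass, h, Measure.smul_apply, smul_eq_mul]
    have hα' := (FiniteMeasure.mass_nonzero_iff _).2 hα
    have hβ' := (FiniteMeasure.mass_nonzero_iff _).2 hβ
    refine Subtype.ext (Measure.ext fun s _ => ?_)
    change (α.normalize : Measure Ω) s = (β.normalize : Measure Ω) s
    rw [FiniteMeasure.toMeasure_normalize_eq_of_nonzero _ hα,
      FiniteMeasure.toMeasure_normalize_eq_of_nonzero _ hβ, h, Measure.smul_apply,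
      Measure.smul_apply, Measure.smul_apply, ENNReal.smul_def, ENNReal.smul_def,
      ENNReal.coe_inv hα', ENNReal.coe_inv hβ', hm, smul_eq_mul, smul_eq_mul, smul_eq_mul,
      ENNReal.mul_inv (Or.inl hc0) (Or.inl hc), ← mul_assoc, mul_right_comm c⁻¹,
      ENNReal.inv_mul_cancel hc0 hc, one_mul]

/-- Moving x and t from the measure into the integrand makes dominated convergence available;
`projIcc` extends f to the line. -/
theorem integral_rawScenery (μ : Measure ℝ) (x t : ℝ) (f : C(unitWindow, ℝ)) :
    ∫ a, f a ∂(rawScenery μ x t) = ∫ y, (window x t).indicator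
      (fun y => f (Set.projIcc (-1) 1 (by norm_num) ((y - x) * Real.exp t))) y ∂μ := by
  have hw : MeasurableSet (window x t) := by rw [window_eq_Icc]; exact measurableSet_Icc
  rw [integral_indicator hw]
  unfold window
  rw [← (zoom_measurableEmbedding x t).map_comap, (zoom_measurableEmbedding x t).integral_map]
  refine integral_congr_ae (.of_forall fun a => ?_)
  have h1 : (zoom x t a - x) * Real.exp t = a := by
    rw [zoom, add_sub_cancel_left, mul_right_comm, ← Real.exp_add, neg_add_cancel, Real.exp_zero,
      one_mul]
  simp only [h1, Set.projIcc_val]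

theorem continuousAt_scenery {μ : Measure ℝ} [IsFiniteMeasure μ] [NullSingletonClass μ] {q : ℝ × ℝ}
    (h : μ (window q.1 q.2) ≠ 0) :
    ContinuousAt (fun q : ℝ × ℝ => scenery μ q.1 q.2) q := by
  refine FiniteMeasure.tendsto_normalize_of_tendsto (μs := fun q : ℝ × ℝ =>
    rawSceneryFinite μ q.1 q.2) ?_ (rawSceneryFinite_ne_zero h)
  refine FiniteMeasure.tendsto_iff_forall_integral_tendsto.2 fun f => ?_
  change Tendsto (fun q : ℝ × ℝ => ∫ a, f a ∂(rawScenery μ q.1 q.2)) (𝓝 q)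
    (𝓝 (∫ a, f a ∂(rawScenery μ q.1 q.2)))
  have hrw := fun q : ℝ × ℝ => integral_rawScenery μ q.1 q.2 f.toContinuousMap
  simp only [BoundedContinuousFunction.coe_toContinuousMap] at hrw
  simp only [hrw]
  have hcont : Continuous fun z : ℝ => f (Set.projIcc (-1) 1 (by norm_num) z) :=
    f.continuous.comp continuous_projIcc
  refine continuousAt_of_dominated (bound := fun _ => ‖f‖) (.of_forall fun q => ?_)
    (.of_forall fun q => .of_forall fun y => ?_) (integrable_const _) ?_
  · refine (Continuous.measurable ?_).indicator ?_ |>.aestronglyMeasurable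
    · exact hcont.comp (by fun_prop)
    · rw [window_eq_Icc]; exact measurableSet_Icc
  · exact (norm_indicator_le_norm_self _ _).trans (f.norm_coe_le_norm _)
  -- The integrand jumps only when y is an endpoint of the window, a null event as `μ` has no atoms.
  · have h1 : ∀ᵐ y ∂μ, y ≠ q.1 - Real.exp (-q.2) := by
      rw [ae_iff]; simp
    have h2 : ∀ᵐ y ∂μ, y ≠ q.1 + Real.exp (-q.2) := by
      rw [ae_iff]; simp
    filter_upwards [h1, h2] with y hy1 hy2
    have hg : ContinuousAt (fun q : ℝ × ℝ => f (Set.projIcc (-1) 1 (by norm_num)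
        ((y - q.1) * Real.exp q.2))) q := by
      refine (hcont.comp (f := fun q : ℝ × ℝ => (y - q.1) * Real.exp q.2) ?_).continuousAt
      fun_prop
    have hl : Continuous fun q : ℝ × ℝ => q.1 - Real.exp (-q.2) := by fun_prop
    have hr : Continuous fun q : ℝ × ℝ => q.1 + Real.exp (-q.2) := by fun_prop
    have hzero : (∀ᶠ q in 𝓝 q, y ∉ window q.1 q.2) → ContinuousAt (fun q : ℝ × ℝ =>
        (window q.1 q.2).indicator (fun y => f (Set.projIcc (-1) 1 (by norm_num)
          ((y - q.1) * Real.exp q.2))) y) q := fun hev =>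
      (continuousAt_const (y := (0 : ℝ))).congr (hev.mono fun q hq =>
        (Set.indicator_of_notMem hq _).symm)
    rcases hy1.lt_or_gt with hlt | hgt
    · refine hzero ?_
      filter_upwards [hl.continuousAt.eventually (lt_mem_nhds hlt)] with q hq hmem
      rw [window_eq_Icc] at hmem
      exact absurd hmem.1 (not_le.2 hq)
    · rcases hy2.lt_or_gt with hlt' | hgt'
      · refine hg.congr ?_
        filter_upwards [hl.continuousAt.eventually (gt_mem_nhds hgt),
          hr.continuousAt.eventually (lt_mem_nhds hlt')] with q hq1 hq2
        rw [Set.indicator_of_mem]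
        rw [window_eq_Icc]
        exact ⟨hq1.le, hq2.le⟩
      · refine hzero ?_
        filter_upwards [hr.continuousAt.eventually (gt_mem_nhds hgt')] with q hq hmem
        rw [window_eq_Icc] at hmem
        exact absurd hmem.2 (not_le.2 hq)

theorem continuous_scenery_of_mem_support {μ : Measure ℝ} [IsFiniteMeasure μ]
    [NullSingletonClass μ] {x : ℝ} (hx : x ∈ μ.support) : Continuous fun t => scenery μ x t :=
  continuous_iff_continuousAt.2 fun t =>
    (continuousAt_scenery (q := (x, t)) (measure_window_ne_zero hx t)).comp
      (f := fun t : ℝ => (x, t)) (by fun_prop)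

namespace PiecewiseLinearShift

variable {Λ : Type*} {σ : PiecewiseLinearShift Λ} [MeasurableSpace Λ] [DiscreteMeasurableSpace Λ]
  {p : Λ → ℝ} {P : Measure Λ} [IsProbabilityMeasure P] [Countable Λ] [Nontrivial Λ]

/-- The hypothesis puts the rescaled window inside I, where self-similarity applies; the factor `p
l` cancels in the normalisation. -/
theorem OrientationPreserving.scenery_affine (hσ : σ.OrientationPreserving) (hp : ∀ l, 0 < p l)
    (hp_sum : HasSum p 1) (hP : ∀ l, P {l} = ENNReal.ofReal (p l))
    {μ : Measure ℝ} [IsProbabilityMeasure μ] (hμ : σ.IsBernoulli p μ) (l : Λ) {y t : ℝ}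
    (h : Real.exp (-t) ≤ σ.rad l * (1 - |y|)) :
    scenery μ (σ.mid l + σ.rad l * y) t = scenery μ y (t + Real.log (σ.rad l)) := by
  have hr := σ.rad_pos l
  have hexp : Real.exp (-(t + Real.log (σ.rad l))) = Real.exp (-t) / σ.rad l := by
    rw [neg_add, Real.exp_add, Real.exp_neg (Real.log _), Real.exp_log hr, div_eq_mul_inv]
  have hsub : window y (t + Real.log (σ.rad l)) ⊆ unitWindow := by
    refine window_subset_unitWindow ?_
    rw [hexp, div_le_iff₀ hr]
    linarith
  have hpl0 : ENNReal.ofReal (p l) ≠ 0 := by simpa using hp l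
  refine FiniteMeasure.normalize_eq_of_eq_smul hpl0 ENNReal.ofReal_ne_top ?_
  change rawScenery μ _ t = ENNReal.ofReal (p l) • rawScenery μ _ _
  refine Measure.ext fun A hA => ?_
  rw [Measure.smul_apply, rawScenery_apply, rawScenery_apply, smul_eq_mul,
    ← hσ.measure_affine_image hp hp_sum hP hμ l
      ((zoom_measurableEmbedding _ _).measurableSet_image.2 hA)
      ((Set.image_subset_range _ _).trans hsub), Set.image_image]
  congr 1
  refine Set.image_congr fun a _ => ?_
  rw [zoom, zoom, hexp]
  field_simp
  ring

/-- The sceneries at a point are, after the entry time, those of its images under the shift. -/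
theorem OrientationPreserving.scenery_code (hσ : σ.OrientationPreserving) (hp : ∀ l, 0 < p l)
    (hp_sum : HasSum p 1) (hP : ∀ l, P {l} = ENNReal.ofReal (p l))
    {μ : Measure ℝ} [IsProbabilityMeasure μ] (hμ : σ.IsBernoulli p μ) (n : ℕ) (ω : ℕ → Λ) {t : ℝ}
    (h : Real.exp (-t) ≤ σ.scale n ω * (1 - |σ.code (seqShift^[n] ω)|)) :
    scenery μ (σ.code ω) t =
      scenery μ (σ.code (seqShift^[n] ω)) (t + Real.log (σ.scale n ω)) := by
  induction n with
  | zero => simp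
  | succ n ih =>
    have hs := σ.scale_pos n ω
    have hle := hσ.rad_mul_le (seqShift^[n] ω)
    rw [seqShift_iterate, zero_add, ← Function.iterate_succ_apply' seqShift] at hle
    rw [scale_succ, mul_assoc] at h
    rw [ih (h.trans (mul_le_mul_of_nonneg_left hle hs.le)), hσ.code_eq' (seqShift^[n] ω),
      hσ.scenery_affine hp hp_sum hP hμ, scale_succ, Real.log_mul hs.ne' (σ.rad_pos _).ne',
      ← Function.iterate_succ_apply' seqShift, seqShift_iterate, zero_add, add_assoc]
    rw [seqShift_iterate, zero_add, ← Function.iterate_succ_apply' seqShift, neg_add, Real.exp_add,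
      Real.exp_neg (Real.log _), Real.exp_log hs, ← div_eq_mul_inv, div_le_iff₀ hs]
    linarith

end PiecewiseLinearShift

/-! ### Entry times -/

/-- Cesàro averages of a bounded function converge if they do along a sequence of times that
grows linearly. -/
theorem tendsto_average_of_tendsto_sequence {h : ℝ → ℝ} (hc : Continuous h) {M : ℝ}
    (hM : ∀ t, |h t| ≤ M) {τ : ℕ → ℝ} {θ J : ℝ} (hθ : 0 < θ)
    (hτ : Tendsto (fun n : ℕ => τ n / n) atTop (𝓝 θ))
    (hJ : Tendsto (fun n : ℕ => (∫ t in (0 : ℝ)..τ n, h t) / n) atTop (𝓝 J)) :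
    Tendsto (fun T : ℝ => T⁻¹ * ∫ t in (0 : ℝ)..T, h t) atTop (𝓝 (θ⁻¹ * J)) := by
  let N : ℝ → ℕ := fun T => ⌊T / θ⌋₊
  have hdiv : Tendsto (fun T : ℝ => T / θ) atTop atTop := tendsto_id.atTop_div_const hθ
  have hN : Tendsto N atTop atTop := tendsto_nat_floor_atTop.comp hdiv
  have hNT : Tendsto (fun T : ℝ => (N T : ℝ) / T) atTop (𝓝 θ⁻¹) := by
    have h1 := ((tendsto_nat_floor_div_atTop (R := ℝ)).comp hdiv).mul_const θ⁻¹
    rw [one_mul] at h1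
    refine h1.congr fun T => ?_
    simp only [Function.comp, N]
    field_simp
  -- With N = ⌊T/θ⌋, replacing T by τ N changes the average by at most M|T - τ N|/T, and τ N / T →
  -- 1.
  have herr : Tendsto (fun T : ℝ => M * |1 - N T / T * (τ (N T) / N T)|) atTop (𝓝 0) := by
    have h1 := ((hNT.mul (hτ.comp hN)).const_sub 1).abs.const_mul M
    rw [inv_mul_cancel₀ hθ.ne', sub_self, abs_zero, mul_zero] at h1
    exact h1
  have hmain := hNT.mul (hJ.comp hN)
  have hdiff : Tendsto (fun T : ℝ => (T⁻¹ * ∫ t in (0 : ℝ)..T, h t) -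
      N T / T * ((∫ t in (0 : ℝ)..τ (N T), h t) / N T)) atTop (𝓝 0) := by
    refine squeeze_zero_norm' ?_ herr
    filter_upwards [eventually_gt_atTop 0, hN.eventually (eventually_gt_atTop 0)] with T hT hn
    have hn' : (N T : ℝ) ≠ 0 := by exact_mod_cast hn.ne'
    have h1 : (T⁻¹ * ∫ t in (0 : ℝ)..T, h t) -
        N T / T * ((∫ t in (0 : ℝ)..τ (N T), h t) / N T) = T⁻¹ * ∫ t in τ (N T)..T, h t := by
      rw [← intervalIntegral.integral_interval_sub_left (hc.intervalIntegrable 0 T)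
        (hc.intervalIntegrable 0 (τ (N T)))]
      field_simp
    have h2 : |1 - N T / T * (τ (N T) / N T)| = T⁻¹ * |T - τ (N T)| := by
      have h3 : 1 - N T / T * (τ (N T) / N T) = T⁻¹ * (T - τ (N T)) := by field_simp
      rw [h3, abs_mul, abs_of_pos (inv_pos.2 hT)]
    rw [h1, h2, norm_mul, Real.norm_eq_abs, abs_of_pos (inv_pos.2 hT), mul_left_comm]
    refine mul_le_mul_of_nonneg_left ?_ (inv_pos.2 hT).le
    exact intervalIntegral.norm_integral_le_of_norm_le_const fun t _ => hM t
  have := hdiff.add hmain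
  rw [zero_add] at this
  exact this.congr fun T => sub_add_cancel _ _

namespace PiecewiseLinearShift

variable {Λ : Type*} (σ : PiecewiseLinearShift Λ)

/-- The entry time into the cylinder of generation `n` in terms of the digits. -/
noncomputable def codeTime (n : ℕ) (ω : ℕ → Λ) : ℝ :=
  -Real.log (σ.scale n ω) - Real.log (1 - |σ.code (seqShift^[n] ω)|)

/-- All images under the shift of the point with digits `ω` lie in the open interval `(-1, 1)`. -/
def IsInterior (ω : ℕ → Λ) : Prop := ∀ n, |σ.code (seqShift^[n] ω)| < 1

variable {σ}

theorem exp_neg_codeTime {ω : ℕ → Λ} (hω : σ.IsInterior ω) (n : ℕ) :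
    Real.exp (-σ.codeTime n ω) = σ.scale n ω * (1 - |σ.code (seqShift^[n] ω)|) := by
  rw [codeTime, neg_sub, sub_neg_eq_add, Real.exp_add, Real.exp_log (sub_pos.2 (hω n)),
    Real.exp_log (σ.scale_pos n ω), mul_comm]

theorem exp_neg_le_iff {ω : ℕ → Λ} (hω : σ.IsInterior ω) (n : ℕ) (t : ℝ) :
    Real.exp (-t) ≤ σ.scale n ω * (1 - |σ.code (seqShift^[n] ω)|) ↔ σ.codeTime n ω ≤ t := by
  rw [← exp_neg_codeTime hω, Real.exp_le_exp, neg_le_neg_iff]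

theorem IsInterior.iterate {ω : ℕ → Λ} (hω : σ.IsInterior ω) (k : ℕ) :
    σ.IsInterior (seqShift^[k] ω) := fun n => by
  rw [← Function.iterate_add_apply]; exact hω _

theorem scale_le_one (n : ℕ) (ω : ℕ → Λ) : σ.scale n ω ≤ 1 := by
  linarith [σ.abs_center_add_scale_le n ω, abs_nonneg (σ.center n ω)]

theorem neg_log_scale_le_codeTime {ω : ℕ → Λ} (hω : σ.IsInterior ω) (n : ℕ) :
    -Real.log (σ.scale n ω) ≤ σ.codeTime n ω := by
  have : Real.log (1 - |σ.code (seqShift^[n] ω)|) ≤ 0 :=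
    Real.log_nonpos (sub_pos.2 (hω n)).le (by linarith [abs_nonneg (σ.code (seqShift^[n] ω))])
  unfold codeTime; linarith

theorem codeTime_nonneg {ω : ℕ → Λ} (hω : σ.IsInterior ω) (n : ℕ) : 0 ≤ σ.codeTime n ω :=
  (neg_nonneg.2 (Real.log_nonpos (σ.scale_pos n ω).le (scale_le_one n ω))).trans
    (neg_log_scale_le_codeTime hω n)

theorem codeTime_zero (ω : ℕ → Λ) : σ.codeTime 0 ω = -Real.log (1 - |σ.code ω|) := by
  simp [codeTime]

theorem codeTime_iterate_zero (n : ℕ) (ω : ℕ → Λ) :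
    σ.codeTime 0 (seqShift^[n] ω) = σ.codeTime n ω + Real.log (σ.scale n ω) := by
  simp only [codeTime, scale_zero, Real.log_one, Function.iterate_zero, id_eq]
  ring

theorem codeTime_iterate_one (n : ℕ) (ω : ℕ → Λ) :
    σ.codeTime 1 (seqShift^[n] ω) = σ.codeTime (n + 1) ω + Real.log (σ.scale n ω) := by
  rw [codeTime, codeTime, scale_succ, scale_zero, one_mul, scale_succ,
    Real.log_mul (σ.scale_pos n ω).ne' (σ.rad_pos _).ne', seqShift_iterate, zero_add,
    Function.iterate_one, Function.iterate_succ_apply']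
  ring

theorem OrientationPreserving.codeTime_le_succ (hσ : σ.OrientationPreserving) {ω : ℕ → Λ}
    (hω : σ.IsInterior ω) (n : ℕ) : σ.codeTime n ω ≤ σ.codeTime (n + 1) ω := by
  rw [← exp_neg_le_iff hω, exp_neg_codeTime hω, scale_succ, mul_assoc]
  have hle := hσ.rad_mul_le (seqShift^[n] ω)
  rw [seqShift_iterate, zero_add, ← Function.iterate_succ_apply' seqShift] at hle
  exact mul_le_mul_of_nonneg_left hle (σ.scale_pos n ω).le

theorem codeTime_eq_birkhoffSum (n : ℕ) (ω : ℕ → Λ) :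
    σ.codeTime n ω = σ.codeTime 0 ω +
      birkhoffSum seqShift (fun ω => σ.codeTime 1 ω - σ.codeTime 0 ω) n ω := by
  induction n with
  | zero => simp
  | succ n ih => rw [birkhoffSum_succ, ← add_assoc, ← ih, codeTime_iterate_zero,
      codeTime_iterate_one]; ring

/-- Disjointness of open cylinders leaves one admissible word, and the window fits in its cylinder
exactly when e^{-t} is at most the distance to the boundary. -/
theorem OrientationPreserving.entryTime_code [Nonempty Λ] (hσ : σ.OrientationPreserving)
    {ω : ℕ → Λ} (hω : σ.IsInterior ω) (n : ℕ) :
    σ.entryTime n (σ.code ω) = ENNReal.ofReal (σ.codeTime n ω) := by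
  have hs := σ.scale_pos n ω
  have hwin : ∀ t, window (σ.code ω) t ⊆ σ.cylinder (fun i : Fin n => ω i) ↔
      σ.codeTime n ω ≤ t := by
    intro t
    rw [← exp_neg_le_iff hω, hσ.cylinder_eq, window_eq_Icc, Set.Icc_subset_Icc_iff
      (by linarith [Real.exp_pos (-t)]), mul_sub, mul_one, ← hσ.abs_code_sub_center, 
      le_sub_comm (a := Real.exp (-t)) (b := σ.scale n ω), abs_le]
    constructor <;> rintro ⟨h1, h2⟩ <;> constructor <;> linarith
  have hint : |σ.code ω - σ.center n ω| < σ.scale n ω := by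
    rw [hσ.abs_code_sub_center]
    exact mul_lt_of_lt_one_right hs (hω n)
  have hmem : ∀ ω' : ℕ → Λ, σ.code ω ∈ interior (σ.cylinder fun i : Fin n => ω' i) ↔
      |σ.code ω - σ.center n ω'| < σ.scale n ω' := by
    intro ω'
    rw [hσ.cylinder_eq, interior_Icc, abs_lt, Set.mem_Ioo]
    constructor <;> rintro ⟨h1, h2⟩ <;> constructor <;> linarith
  refine le_antisymm (sInf_le ⟨fun i => ω i, σ.codeTime n ω, (hmem ω).2 hint,
    codeTime_nonneg hω n, (hwin _).2 le_rfl, rfl⟩) (le_sInf ?_)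
  rintro _ ⟨w, t, hw, -, hwt, rfl⟩
  have hww : (fun i : Fin n => wordExtend w i) = w := by funext i; simp
  rw [← hww, hmem] at hw
  have heq := hσ.eq_of_mem hw hint
  have hw' : w = fun i : Fin n => ω i := by
    funext i; rw [← heq i i.2, wordExtend_apply]
  rw [hw', hwin] at hwt
  exact ENNReal.ofReal_le_ofReal hwt

theorem OrientationPreserving.toReal_entryTime_code [Nonempty Λ] (hσ : σ.OrientationPreserving)
    {ω : ℕ → Λ} (hω : σ.IsInterior ω) (n : ℕ) :
    (σ.entryTime n (σ.code ω)).toReal = σ.codeTime n ω := by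
  rw [hσ.entryTime_code hω, ENNReal.toReal_ofReal (codeTime_nonneg hω n)]

variable [MeasurableSpace Λ] [DiscreteMeasurableSpace Λ] {p : Λ → ℝ} {P : Measure Λ}
  [IsProbabilityMeasure P]

theorem OrientationPreserving.ae_isInterior [Nontrivial Λ] (hσ : σ.OrientationPreserving)
    (hp : ∀ l, 0 < p l) (hp_sum : HasSum p 1) (hP : ∀ l, P {l} = ENNReal.ofReal (p l)) :
    ∀ᵐ ω ∂(Measure.infinitePi fun _ : ℕ => P), σ.IsInterior ω := by
  have hna := hσ.noAtoms_map_code hp hp_sum hP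
  have hne : ∀ c : ℝ, ∀ᵐ ω ∂(Measure.infinitePi fun _ : ℕ => P), σ.code ω ≠ c := fun c => by
    refine ae_of_ae_map hσ.measurable_code.aemeasurable (p := fun x => x ≠ c) ?_
    rw [ae_iff]; simp
  have h1 : ∀ᵐ ω ∂(Measure.infinitePi fun _ : ℕ => P), |σ.code ω| < 1 := by
    filter_upwards [hne 1, hne (-1)] with ω h h'
    refine lt_of_le_of_ne (hσ.abs_code_le ω) fun habs => ?_
    rcases eq_or_eq_neg_of_abs_eq habs with h0 | h0
    · exact h h0
    · exact h' h0
  exact ae_all_iff.2 fun n => ((ergodic_seqShift P).toMeasurePreserving.iterate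
    n).quasiMeasurePreserving.ae h1

/-- Between successive entry times, the integral of a function of the scenery is given by the
shifted point. -/
theorem OrientationPreserving.integral_scenery_eq_birkhoffSum [Countable Λ] [Nontrivial Λ]
    (hσ : σ.OrientationPreserving) (hp : ∀ l, 0 < p l) (hp_sum : HasSum p 1)
    (hP : ∀ l, P {l} = ENNReal.ofReal (p l)) {μ : Measure ℝ} [IsProbabilityMeasure μ]
    (hμ : σ.IsBernoulli p μ) {ω : ℕ → Λ} (hω : σ.IsInterior ω) (g : ProbWindow → ℝ)
    (hg : Continuous fun t => g (scenery μ (σ.code ω) t)) (n : ℕ) :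
    ∫ t in σ.codeTime 0 ω..σ.codeTime n ω, g (scenery μ (σ.code ω) t) =
      birkhoffSum seqShift (fun ω => ∫ t in σ.codeTime 0 ω..σ.codeTime 1 ω,
        g (scenery μ (σ.code ω) t)) n ω := by
  induction n with
  | zero => simp
  | succ n ih =>
    rw [birkhoffSum_succ, ← ih, ← intervalIntegral.integral_add_adjacent_intervals
      (hg.intervalIntegrable _ (σ.codeTime n ω)) (hg.intervalIntegrable _ _), codeTime_iterate_zero,
      codeTime_iterate_one, ← intervalIntegral.integral_comp_add_right (fun t =>
        g (scenery μ (σ.code (seqShift^[n] ω)) t))]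
    congr 1
    -- On this interval t is at least the n-th entry time, exactly the condition of `scenery_code`.
    refine intervalIntegral.integral_congr fun t ht => ?_
    rw [Set.uIcc_of_le (hσ.codeTime_le_succ hω n)] at ht
    simp only [hσ.scenery_code hp hp_sum hP hμ n ω ((exp_neg_le_iff hω n t).2 ht.1)]

end PiecewiseLinearShift

/-! ### The space of distributions -/

instance ProbWindow.instCompactSpace : CompactSpace ProbWindow :=
  inferInstanceAs (CompactSpace (ProbabilityMeasure unitWindow))

instance ProbWindow.instMetrizableSpace : TopologicalSpace.MetrizableSpace ProbWindow :=
  inferInstanceAs (TopologicalSpace.MetrizableSpace (ProbabilityMeasure unitWindow))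

instance ProbWindow.instSecondCountableTopology : SecondCountableTopology ProbWindow :=
  letI := TopologicalSpace.metrizableSpaceMetric ProbWindow
  inferInstance

theorem ContinuousMap.exists_forall_abs_le {X : Type*} [TopologicalSpace X] [CompactSpace X]
    (g : C(X, ℝ)) : ∃ M : ℝ, ∀ x, |g x| ≤ M :=
  ⟨‖g‖, fun x => g.norm_coe_le_norm x⟩

theorem probabilityMeasure_eq_iff_forall_integral_eq {X : Type*} [TopologicalSpace X]
    [MeasurableSpace X] [BorelSpace X] [HasOuterApproxClosed X] {Q P : ProbabilityMeasure X} :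
    (∀ g : C(X, ℝ), ∫ x, g x ∂(Q : Measure X) = ∫ x, g x ∂(P : Measure X)) ↔ Q = P := by
  constructor
  · intro h
    have hQP : (Q : Measure X) = P :=
      ext_of_forall_integral_eq_of_IsFiniteMeasure fun f => h f.toContinuousMap
    exact Subtype.ext hQP
  · rintro rfl g
    rfl

/-! ### Integration over the region between two graphs -/

section Region

variable {X : Type*} [MeasurableSpace X] {μ : Measure X} {a b : X → ℝ}

theorem restrict_regionBetween_univ (ha : Measurable a) (hb : Measurable b)
    (hab : ∀ᵐ x ∂μ, a x ≤ b x) (hint : Integrable (fun x => b x - a x) μ) :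
    (μ.prod volume).restrict (regionBetween a b Set.univ) Set.univ =
      ENNReal.ofReal (∫ x, (b x - a x) ∂μ) := by
  rw [Measure.restrict_apply_univ, volume_regionBetween_eq_lintegral' ha hb .univ,
    Measure.restrict_univ, ofReal_integral_eq_lintegral_ofReal hint]
  · rfl
  · filter_upwards [hab] with x hx using sub_nonneg.2 hx

theorem integral_regionBetween [SFinite μ] (ha : Measurable a) (hb : Measurable b)
    (hab : ∀ᵐ x ∂μ, a x ≤ b x) {f : X × ℝ → ℝ}
    (hf : Integrable f ((μ.prod volume).restrict (regionBetween a b Set.univ))) :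
    Integrable (fun x => ∫ t in a x..b x, f (x, t)) μ ∧
      ∫ q, f q ∂((μ.prod volume).restrict (regionBetween a b Set.univ)) =
        ∫ x, (∫ t in a x..b x, f (x, t)) ∂μ := by
  have hm := measurableSet_regionBetween ha hb MeasurableSet.univ
  have hf' := (integrable_indicator_iff hm).2 hf
  have heq : (fun x => ∫ t, (regionBetween a b Set.univ).indicator f (x, t)) =ᵐ[μ]
      fun x => ∫ t in a x..b x, f (x, t) := by
    filter_upwards [hab] with x hx
    rw [intervalIntegral.integral_of_le hx, integral_Ioc_eq_integral_Ioo,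
      ← integral_indicator measurableSet_Ioo]
    refine integral_congr_ae (.of_forall fun t => ?_)
    by_cases ht : t ∈ Set.Ioo (a x) (b x)
    · have : (x, t) ∈ regionBetween a b Set.univ := ⟨trivial, ht⟩
      simp only [Set.indicator_of_mem this, Set.indicator_of_mem ht]
    · have : (x, t) ∉ regionBetween a b Set.univ := fun h => ht h.2
      simp only [Set.indicator_of_notMem this, Set.indicator_of_notMem ht]
  refine ⟨hf'.integral_prod_left.congr heq, ?_⟩
  rw [← integral_indicator hm, integral_prod _ hf']
  exact integral_congr_ae heq

end Region

/-- The average of the sceneries between two times depending on the point. -/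
theorem exists_average_scenery {μ : Measure ℝ} [IsProbabilityMeasure μ] [NullSingletonClass μ]
    {a b : ℝ → ℝ} (ha : AEMeasurable a μ) (hb : AEMeasurable b μ) (hab : ∀ᵐ x ∂μ, a x ≤ b x)
    (hint : Integrable (fun x => b x - a x) μ) (hpos : 0 < ∫ x, (b x - a x) ∂μ) :
    ∃ P : ProbabilityMeasure ProbWindow, ∀ g : C(ProbWindow, ℝ),
      Integrable (fun x => ∫ t in a x..b x, g (scenery μ x t)) μ ∧
      ∫ ν, g ν ∂(P : Measure ProbWindow) = (∫ x, (b x - a x) ∂μ)⁻¹ *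
        ∫ x, (∫ t in a x..b x, g (scenery μ x t)) ∂μ := by
  wlog hm : Measurable a ∧ Measurable b generalizing a b
  · have hsub : (fun x => hb.mk b x - ha.mk a x) =ᵐ[μ] fun x => b x - a x := by
      filter_upwards [ha.ae_eq_mk, hb.ae_eq_mk] with x h1 h2
      rw [h1, h2]
    obtain ⟨P, hP⟩ := this (a := ha.mk a) (b := hb.mk b) ha.measurable_mk.aemeasurable
      hb.measurable_mk.aemeasurable
      (by filter_upwards [hab, ha.ae_eq_mk, hb.ae_eq_mk] with x h h1 h2; rwa [← h1, ← h2])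
      (hint.congr hsub.symm) (by rwa [integral_congr_ae hsub]) ⟨ha.measurable_mk, hb.measurable_mk⟩
    refine ⟨P, fun g => ?_⟩
    have hg : (fun x => ∫ t in ha.mk a x..hb.mk b x, g (scenery μ x t)) =ᵐ[μ]
        fun x => ∫ t in a x..b x, g (scenery μ x t) := by
      filter_upwards [ha.ae_eq_mk, hb.ae_eq_mk] with x h1 h2
      rw [h1, h2]
    rw [← integral_congr_ae hsub, ← integral_congr_ae hg]
    exact ⟨(hP g).1.congr hg, (hP g).2⟩
  obtain ⟨ha, hb⟩ := hm
  set θ := ∫ x, (b x - a x) ∂μ with hθ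
  set ρ := (μ.prod volume).restrict (regionBetween a b Set.univ) with hρ
  have hmass : ρ Set.univ = ENNReal.ofReal θ := restrict_regionBetween_univ ha hb hab hint
  have hfin : IsFiniteMeasure ρ := ⟨by rw [hmass]; exact ENNReal.ofReal_lt_top⟩
  have hsupp : MeasurableSet (μ.support ×ˢ (Set.univ : Set ℝ)) :=
    Measure.isClosed_support.measurableSet.prod .univ
  have hmem : ∀ᵐ q ∂ρ, q ∈ μ.support ×ˢ (Set.univ : Set ℝ) := by
    refine ae_restrict_of_ae ?_
    have h1 : ∀ᵐ q ∂(μ.prod (volume : Measure ℝ)), q.1 ∈ μ.support :=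
      Measure.quasiMeasurePreserving_fst.ae Measure.support_mem_ae
    filter_upwards [h1] with q hq using ⟨hq, trivial⟩
  -- Continuity of the scenery is available only over the support of `μ`, which carries `ρ`. The
  -- distribution sought is the image of the normalised `ρ`.
  have hsc : AEMeasurable (fun q : ℝ × ℝ => scenery μ q.1 q.2) ρ := by
    rw [← Measure.restrict_eq_self_of_ae_mem hmem]
    refine ContinuousOn.aemeasurable (fun q hq => ?_) hsupp
    exact (continuousAt_scenery (measure_window_ne_zero hq.1 q.2)).continuousWithinAt
  have hθ0 : ENNReal.ofReal θ ≠ 0 := by simpa using hpos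
  have hprob : IsProbabilityMeasure ((ENNReal.ofReal θ)⁻¹ •
      ρ.map fun q : ℝ × ℝ => scenery μ q.1 q.2) := by
    refine ⟨?_⟩
    rw [Measure.smul_apply, Measure.map_apply_of_aemeasurable hsc .univ, Set.preimage_univ, hmass,
      smul_eq_mul, ENNReal.inv_mul_cancel hθ0 ENNReal.ofReal_ne_top]
  refine ⟨⟨_, hprob⟩, fun g => ?_⟩
  obtain ⟨M, hM⟩ := g.exists_forall_abs_le
  have hgint : Integrable (fun q : ℝ × ℝ => g (scenery μ q.1 q.2)) ρ :=
    Integrable.of_bound (g.continuous.measurable.comp_aemeasurable hsc).aestronglyMeasurable M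
      (.of_forall fun q => hM _)
  obtain ⟨h1, h2⟩ := integral_regionBetween ha hb hab hgint
  refine ⟨h1, ?_⟩
  change ∫ ν, g ν ∂((ENNReal.ofReal θ)⁻¹ • ρ.map fun q : ℝ × ℝ => scenery μ q.1 q.2) = _
  rw [integral_smul_measure, integral_map hsc g.continuous.measurable.aestronglyMeasurable, h2,
    ENNReal.toReal_inv, ENNReal.toReal_ofReal hpos.le, smul_eq_mul]

theorem integral_sceneryDistribution {μ : Measure ℝ} [IsFiniteMeasure μ] [NullSingletonClass μ]
    {x : ℝ} (hx : x ∈ μ.support) {T : ℝ} (hT : 0 < T) (g : C(ProbWindow, ℝ)) :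
    ∫ ν, g ν ∂(sceneryDistribution μ x T) = T⁻¹ * ∫ t in (0 : ℝ)..T, g (scenery μ x t) := by
  rw [sceneryDistribution, integral_smul_measure,
    integral_map (continuous_scenery_of_mem_support hx).measurable.aemeasurable
      g.continuous.measurable.aestronglyMeasurable, ENNReal.toReal_inv,
    ENNReal.toReal_ofReal hT.le, smul_eq_mul, intervalIntegral.integral_of_le hT.le,
    integral_Icc_eq_integral_Ioc]

/-- It suffices to test the generation of a distribution on a dense set of functions. -/
theorem generates_of_dense {μ : Measure ℝ} [IsFiniteMeasure μ] [NullSingletonClass μ] {x : ℝ}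
    (hx : x ∈ μ.support) {P : ProbabilityMeasure ProbWindow} {D : Set C(ProbWindow, ℝ)}
    (hD : Dense D)
    (h : ∀ g ∈ D, Tendsto (fun T : ℝ => T⁻¹ * ∫ t in (0 : ℝ)..T, g (scenery μ x t)) atTop
      (𝓝 (∫ ν, g ν ∂(P : Measure ProbWindow)))) : Generates μ x P := by
  refine ⟨hx, fun g => ?_⟩
  have hev : ∀ g : C(ProbWindow, ℝ), (fun T : ℝ => ∫ ν, g ν ∂(sceneryDistribution μ x T)) =ᶠ[atTop]
      fun T : ℝ => T⁻¹ * ∫ t in (0 : ℝ)..T, g (scenery μ x t) := fun g => by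
    filter_upwards [eventually_gt_atTop 0] with T hT using integral_sceneryDistribution hx hT g
  refine Tendsto.congr' (hev g).symm ?_
  have hcont : ∀ g : C(ProbWindow, ℝ), Continuous fun t => g (scenery μ x t) := fun g =>
    g.continuous.comp (continuous_scenery_of_mem_support hx)
  have hInt : ∀ (m : Measure ProbWindow) [IsFiniteMeasure m] (g : C(ProbWindow, ℝ)),
      Integrable g m := fun m _ g => by
    obtain ⟨M, hM⟩ := g.exists_forall_abs_le
    exact Integrable.of_bound g.continuous.measurable.aestronglyMeasurable M (.of_forall hM)
  rw [Metric.tendsto_atTop]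
  intro ε hε
  obtain ⟨f, hfD, hf⟩ := hD.exists_dist_lt g (show 0 < ε / 3 by linarith)
  have hgf : ∀ ν, |g ν - f ν| ≤ ε / 3 := fun ν =>
    ((g - f).norm_coe_le_norm ν).trans (by rw [← dist_eq_norm]; exact hf.le)
  obtain ⟨N, hN⟩ := Metric.tendsto_atTop.1 (h f hfD) (ε / 3) (by linarith)
  refine ⟨max N 1, fun T hT => ?_⟩
  have hT0 : 0 < T := one_pos.trans_le ((le_max_right _ _).trans hT)
  have h1 := hN T ((le_max_left _ _).trans hT)
  have h2 : |T⁻¹ * (∫ t in (0 : ℝ)..T, g (scenery μ x t)) -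
      T⁻¹ * ∫ t in (0 : ℝ)..T, f (scenery μ x t)| ≤ ε / 3 := by
    rw [← mul_sub, ← intervalIntegral.integral_sub ((hcont g).intervalIntegrable _ _)
      ((hcont f).intervalIntegrable _ _), abs_mul, abs_of_pos (inv_pos.2 hT0)]
    have h3 := intervalIntegral.norm_integral_le_of_norm_le_const (a := 0) (b := T)
      (f := fun t => g (scenery μ x t) - f (scenery μ x t)) fun t _ => hgf (scenery μ x t)
    rw [sub_zero, abs_of_pos hT0, Real.norm_eq_abs] at h3
    rw [inv_mul_le_iff₀ hT0]
    linarith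
  have h4 : |(∫ ν, g ν ∂(P : Measure ProbWindow)) - ∫ ν, f ν ∂(P : Measure ProbWindow)| ≤ ε / 3 := by
    rw [← integral_sub (hInt _ g) (hInt _ f)]
    have h5 := norm_integral_le_of_norm_le_const (μ := (P : Measure ProbWindow))
      (f := fun ν => g ν - f ν) (.of_forall hgf)
    simpa using h5
  rw [Real.dist_eq] at h1 ⊢
  rw [abs_lt] at h1 ⊢
  rw [abs_le] at h2 h4
  constructor <;> linarith [h1.1, h1.2, h2.1, h2.2, h4.1, h4.2]

/-! ### Sceneries of Bernoulli measures -/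

theorem exists_isProbabilityMeasure_singleton {Λ : Type*} [MeasurableSpace Λ]
    [DiscreteMeasurableSpace Λ] {p : Λ → ℝ} (hp : ∀ l, 0 < p l) (hp_sum : HasSum p 1) :
    ∃ P : Measure Λ, IsProbabilityMeasure P ∧ ∀ l, P {l} = ENNReal.ofReal (p l) := by
  have hsum : HasSum (fun l => ENNReal.ofReal (p l)) 1 := by
    rw [ENNReal.summable.hasSum_iff, ← ENNReal.ofReal_tsum_of_nonneg (fun l => (hp l).le)
      hp_sum.summable, hp_sum.tsum_eq, ENNReal.ofReal_one]
  let π : PMF Λ := ⟨fun l => ENNReal.ofReal (p l), hsum⟩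
  refine ⟨π.toMeasure, inferInstance, fun l => ?_⟩
  exact PMF.toMeasure_apply_singleton _ _ (measurableSet_singleton l)

namespace PiecewiseLinearShift

variable {Λ : Type*} {σ : PiecewiseLinearShift Λ}

theorem OrientationPreserving.mul_log_le_codeTime (hσ : σ.OrientationPreserving) :
    ∃ c : ℝ, 0 < c ∧ ∀ ω : ℕ → Λ, σ.IsInterior ω → ∀ n : ℕ, n * c ≤ σ.codeTime n ω := by
  obtain ⟨κ, h0, h1, hκ⟩ := hσ.exists_rad_le
  refine ⟨-Real.log κ, neg_pos.2 (Real.log_neg h0 h1), fun ω hω n => ?_⟩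
  have h := Real.log_le_log (σ.scale_pos n ω) (σ.scale_le_pow hκ n ω)
  rw [Real.log_pow] at h
  linarith [neg_log_scale_le_codeTime hω n]

theorem OrientationPreserving.injOn_code (hσ : σ.OrientationPreserving) :
    Set.InjOn σ.code {ω | σ.IsInterior ω} := by
  intro ω hω ω' hω' h
  have hmem : ∀ (ω : ℕ → Λ) (_ : σ.IsInterior ω) (n : ℕ),
      |σ.code ω - σ.center n ω| < σ.scale n ω := fun ω hω n => by
    rw [hσ.abs_code_sub_center]
    exact mul_lt_of_lt_one_right (σ.scale_pos n ω) (hω n)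
  funext n
  have h' := hmem ω' hω' (n + 1)
  rw [← h] at h'
  exact hσ.eq_of_mem (hmem ω hω (n + 1)) h' n n.lt_succ_self

variable [MeasurableSpace Λ] {P : Measure Λ} [IsProbabilityMeasure P]

theorem ae_tendsto_codeTime_div
    (hint : Integrable (fun ω => σ.codeTime 1 ω - σ.codeTime 0 ω)
      (Measure.infinitePi fun _ : ℕ => P)) :
    ∀ᵐ ω ∂(Measure.infinitePi fun _ : ℕ => P), Tendsto (fun n : ℕ => σ.codeTime n ω / n) atTop
      (𝓝 (∫ ω, (σ.codeTime 1 ω - σ.codeTime 0 ω) ∂(Measure.infinitePi fun _ : ℕ => P))) := by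
  filter_upwards [(ergodic_seqShift P).ae_tendsto_birkhoffSum_div hint] with ω hω
  have h := (tendsto_const_div_atTop_nhds_zero_nat (σ.codeTime 0 ω)).add hω
  rw [zero_add] at h
  refine h.congr fun n => ?_
  rw [← add_div, ← codeTime_eq_birkhoffSum]

/-- Almost every point has a sequence of digits with any given almost sure property. -/
theorem OrientationPreserving.ae_map_code_exists [Countable Λ] [DiscreteMeasurableSpace Λ]
    (hσ : σ.OrientationPreserving) {ν : Measure (ℕ → Λ)} {Q : (ℕ → Λ) → Prop}
    (hQ : ∀ᵐ ω ∂ν, Q ω) (hint : ∀ᵐ ω ∂ν, σ.IsInterior ω) :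
    ∀ᵐ x ∂(ν.map σ.code), ∃ ω, Q ω ∧ σ.IsInterior ω ∧ σ.code ω = x := by
  obtain ⟨N, hN, hNm, hN0⟩ := exists_measurable_superset_of_null (ae_iff.1 (hQ.and hint))
  have hgood : ∀ ω ∉ N, Q ω ∧ σ.IsInterior ω := fun ω hω => by
    by_contra hcon
    exact hω (hN hcon)
  -- The Lusin–Souslin theorem: an injective measurable image of a measurable set is measurable, so
  -- the almost sure property can be transported to the line.
  have himg : MeasurableSet (σ.code '' Nᶜ) :=
    hNm.compl.image_of_measurable_injOn hσ.measurable_code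
      (hσ.injOn_code.mono fun ω hω => (hgood ω hω).2)
  have hmem : ∀ᵐ x ∂(ν.map σ.code), x ∈ σ.code '' Nᶜ := by
    refine (ae_map_iff hσ.measurable_code.aemeasurable himg).2 ?_
    refine measure_mono_null (fun ω hω => ?_) hN0
    by_contra hcon
    exact hω ⟨ω, hcon, rfl⟩
  filter_upwards [hmem] with x ⟨ω, hω, hx⟩
  exact ⟨ω, (hgood ω hω).1, (hgood ω hω).2, hx⟩

end PiecewiseLinearShift

theorem mainTheorem6 {Λ : Type*} [Countable Λ] [Nontrivial Λ]
    (σ : PiecewiseLinearShift Λ) (hσ : σ.OrientationPreserving)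
    (p : Λ → ℝ) (hp : ∀ l, 0 < p l) (hp_sum : HasSum p 1)
    (μ : Measure ℝ) [IsProbabilityMeasure μ] (hμ : σ.IsBernoulli p μ)
    (hT : Integrable (fun x => (σ.entryTime 1 x).toReal - (σ.entryTime 0 x).toReal) μ) :
    0 < ∫ x, ((σ.entryTime 1 x).toReal - (σ.entryTime 0 x).toReal) ∂μ ∧
    ∃ P : ProbabilityMeasure ProbWindow,
      (∀ Q : ProbabilityMeasure ProbWindow,
        (∀ g : C(ProbWindow, ℝ),
          ∫ ν, g ν ∂(Q : Measure ProbWindow) =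
            (∫ x, ((σ.entryTime 1 x).toReal - (σ.entryTime 0 x).toReal) ∂μ)⁻¹ *
              ∫ x, (∫ t in (σ.entryTime 0 x).toReal..(σ.entryTime 1 x).toReal,
                g (scenery μ x t)) ∂μ) ↔ Q = P) ∧
      ∀ᵐ x ∂μ, Generates μ x P := by
  let _ : MeasurableSpace Λ := ⊤
  have _ : DiscreteMeasurableSpace Λ := ⟨fun _ => trivial⟩
  obtain ⟨P₀, hP₀, hP⟩ := exists_isProbabilityMeasure_singleton hp hp_sum
  have hmap := hσ.eq_map_code hp hp_sum hP hμ
  have hna : NullSingletonClass μ := hmap ▸ hσ.noAtoms_map_code hp hp_sum hP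
  have hint := hσ.ae_isInterior hp hp_sum hP
  set ν := Measure.infinitePi fun _ : ℕ => P₀ with hν
  have hmp : MeasurePreserving σ.code ν μ := ⟨hσ.measurable_code, hmap⟩
  have hex : ∀ {Q : (ℕ → Λ) → Prop}, (∀ᵐ ω ∂ν, Q ω) →
      ∀ᵐ x ∂μ, ∃ ω, Q ω ∧ σ.IsInterior ω ∧ σ.code ω = x := fun hQ =>
    hmap ▸ hσ.ae_map_code_exists hQ hint
  have hT0 : AEMeasurable (fun x => (σ.entryTime 0 x).toReal) μ := by
    have hm : Measurable fun x : ℝ => -Real.log (1 - |x|) := by fun_prop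
    refine hm.aemeasurable.congr ?_
    filter_upwards [hex hint] with x ⟨ω, hω, _, hx⟩
    rw [← hx, hσ.toReal_entryTime_code hω, PiecewiseLinearShift.codeTime_zero]
  -- T_0 is almost everywhere -log(1 - |x|), so measurability of T_1 follows from that of the
  -- integrable difference.
  have hT1 : AEMeasurable (fun x => (σ.entryTime 1 x).toReal) μ :=
    (hT.aemeasurable.add hT0).congr (.of_forall fun x => sub_add_cancel _ _)
  have hle : ∀ᵐ x ∂μ, (σ.entryTime 0 x).toReal ≤ (σ.entryTime 1 x).toReal := by
    filter_upwards [hex hint] with x ⟨ω, hω, _, hx⟩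
    rw [← hx, hσ.toReal_entryTime_code hω, hσ.toReal_entryTime_code hω]
    exact hσ.codeTime_le_succ hω 0
  have hcomp : (fun ω => (σ.entryTime 1 (σ.code ω)).toReal - (σ.entryTime 0 (σ.code ω)).toReal)
      =ᵐ[ν] fun ω => σ.codeTime 1 ω - σ.codeTime 0 ω := by
    filter_upwards [hint] with ω hω
    rw [hσ.toReal_entryTime_code hω, hσ.toReal_entryTime_code hω]
  have hlift : ∀ f : ℝ → ℝ, AEStronglyMeasurable f μ → ∫ x, f x ∂μ = ∫ ω, f (σ.code ω) ∂ν := by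
    intro f hf
    rw [← hmap] at hf ⊢
    exact integral_map hσ.measurable_code.aemeasurable hf
  have hθ := (hlift _ hT.aestronglyMeasurable).trans (integral_congr_ae hcomp)
  have hlim := PiecewiseLinearShift.ae_tendsto_codeTime_div ((hmp.integrable_comp_of_integrable hT).congr hcomp)
  rw [← hθ] at hlim
  have hpos : 0 < ∫ x, ((σ.entryTime 1 x).toReal - (σ.entryTime 0 x).toReal) ∂μ := by
    obtain ⟨c, hc, hcτ⟩ := hσ.mul_log_le_codeTime
    obtain ⟨ω, hω, hω'⟩ := (hlim.and hint).exists
    refine hc.trans_le (ge_of_tendsto hω ?_)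
    filter_upwards [eventually_gt_atTop 0] with n hn
    have hn' : (0 : ℝ) < n := by exact_mod_cast hn
    rw [le_div_iff₀ hn', mul_comm]
    exact hcτ ω hω' n
  obtain ⟨P, hPg⟩ := exists_average_scenery hT0 hT1 hle hT hpos
  refine ⟨hpos, P, fun Q => ?_, ?_⟩
  · rw [← probabilityMeasure_eq_iff_forall_integral_eq]
    simp only [(hPg _).2]
  obtain ⟨D, hDc, hD⟩ := TopologicalSpace.exists_countable_dense C(ProbWindow, ℝ)
  have hbirk : ∀ᵐ ω ∂ν, ∀ g ∈ D, Tendsto (fun n : ℕ => birkhoffSum seqShift (fun ω =>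
      ∫ t in σ.codeTime 0 ω..σ.codeTime 1 ω, g (scenery μ (σ.code ω) t)) n ω / n) atTop
      (𝓝 (∫ x, (∫ t in (σ.entryTime 0 x).toReal..(σ.entryTime 1 x).toReal,
        g (scenery μ x t)) ∂μ)) := by
    refine (ae_ball_iff hDc).2 fun g _ => ?_
    have hg : (fun ω => ∫ t in (σ.entryTime 0 (σ.code ω)).toReal..(σ.entryTime 1
        (σ.code ω)).toReal, g (scenery μ (σ.code ω) t)) =ᵐ[ν] fun ω =>
        ∫ t in σ.codeTime 0 ω..σ.codeTime 1 ω, g (scenery μ (σ.code ω) t) := by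
      filter_upwards [hint] with ω hω
      rw [hσ.toReal_entryTime_code hω, hσ.toReal_entryTime_code hω]
    rw [hlift _ (hPg g).1.aestronglyMeasurable, integral_congr_ae hg]
    exact (ergodic_seqShift P₀).ae_tendsto_birkhoffSum_div
      ((hmp.integrable_comp_of_integrable (hPg g).1).congr hg)
  filter_upwards [hex (hbirk.and hlim), Measure.support_mem_ae (μ := μ)] with
    x ⟨ω, ⟨hω, hωτ⟩, hωi, hx⟩ hxs
  refine generates_of_dense hxs hD fun g hg => ?_
  have hcont : Continuous fun t => g (scenery μ x t) :=
    g.continuous.comp (continuous_scenery_of_mem_support hxs)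
  obtain ⟨M, hM⟩ := g.exists_forall_abs_le
  rw [(hPg g).2]
  refine tendsto_average_of_tendsto_sequence hcont (fun t => hM _) hpos hωτ ?_
  -- The piece over [0, T_0] is a fixed number for given x, so it vanishes after division by n; T_0
  -- need not be integrable.
  have h0 := tendsto_const_div_atTop_nhds_zero_nat
    (∫ t in (0 : ℝ)..σ.codeTime 0 ω, g (scenery μ x t))
  have hsum := h0.add (hω g hg)
  rw [zero_add] at hsum
  refine hsum.congr fun n => ?_
  subst hx
  rw [← add_div, ← hσ.integral_scenery_eq_birkhoffSum hp hp_sum hP hμ hωi g hcont,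
    intervalIntegral.integral_add_adjacent_intervals (hcont.intervalIntegrable _ _)
      (hcont.intervalIntegrable _ _)]
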